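/- **Setting and definitions.** Let $(X,d)$ be a metric space with a Borel measure $\mu$, and write $B(x,r)=\{y: d(x,y)<r\}$. The measure $\mu$ is *$n$-Ahlfors–David regular* if there are constants $c_l,c_u>0$ with $c_l r^{n}\le \mu(B(x,r))\le c_u r^{n}$ for all $x\in X$ and all $0<r<\operatorname{diam}X$ (where $\operatorname{diam} X\le\infty$). An open connected set $\Omega\subset X$ is a *John domain* if there are a point $x_0\in\Omega$ and a constant $c_J>0$ such that every $x\in\Omega$ can be joined to $x_0$ by a rectifiable curve $c:[0,l]\to\Omega$, parametrized by arc length, with $c(0)=x$, $c(l)=x_0$ and $d(c(t),X\setminus\Omega)\ge t/c_J$ for all $t\in[0,l]$. Write $d(x)=d(x,\partial\Omega)$ and $d_F(x)=d(x,F)$ for the distances from a point to the boundary of $\Omega$ and to a set $F\subset\partial\Omega$. **Theorem.** Let $\mu$ be $n_\mu$-Ahlfors–David regular on $(X,d)$, let $s,\tau\in(0,1)$, $0\le\gamma<s\le n_\mu$, and let $1<p<\infty$ satisfy $(s-\gamma)p<n_\mu$. Put $$p^*=\frac{n_\mu p}{n_\mu-(s-\gamma)p}.$$ Let $\Omega\subset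 X$ be a bounded John domain and let $K$ be a real number. Then there is a constant $C<\infty$ such that the following holds for every nonempty compact set $F\subset\partial\Omega$, every positive nondecreasing function $\phi$ on $(0,\infty)$ with $\phi(2t)\le K\phi(t)$ for all $t>0$, and every $\mu$-measurable function $u:\Omega\to\mathbb R$ (in particular every $u$ in the fractional Sobolev space $W^{s,p}(\Omega,\mu)$): $$\inf_{a\in\mathbb R}\Big(\int_\Omega |u(x)-a|^{p^*}\,\phi(d_F(x))\,d\mu(x)\Big)^{1/p^*}\le C\left(\int_\Omega\int_{\{z\in\Omega:\,d(z,y)\le\tau d(y)\}}\frac{|u(z)-u(y)|^p\,v(z,y)}{\mu\big(B(z,d(z,y))\big)\,d(z,y)^{sp}}\,d\mu(z)\,d\mu(y)\right)^{1/p},$$ where both sides may be $+\infty$ and $$v(z,y)=\min_{x\in\{z,y\}} d(x)^{\gamma p}\,\phi(d_F(x))^{p/p^*}.$$ -/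

import Mathlib

open MeasureTheory Set
open scoped ENNReal NNReal

noncomputable section

/-- `μ` is `n`-Ahlfors–David regular: `c_l r ^ n ≤ μ (B(x, r)) ≤ c_u r ^ n` for some positive
constants, every centre `x` and every radius `0 < r < diam X` (the diameter may be infinite). -/
def IsAhlforsRegular {X : Type*} [MetricSpace X] [MeasurableSpace X]
    (μ : Measure X) (n : ℝ) : Prop :=
  ∃ cl cu : ℝ, 0 < cl ∧ 0 < cu ∧ ∀ (x : X) (r : ℝ), 0 < r →
    ENNReal.ofReal r < Metric.ediam (univ : Set X) →
      ENNReal.ofReal (cl * r ^ n) ≤ μ (Metric.ball x r) ∧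
        μ (Metric.ball x r) ≤ ENNReal.ofReal (cu * r ^ n)

/-- A John domain: an open connected set with a central point `x₀` and a constant `cJ > 0` such
that every `x ∈ Ω` is joined to `x₀` inside `Ω` by a rectifiable curve, parametrized on `[0, l]` by
its arc length, whose point at arc length `t` from `x` has distance at least `t / cJ` to the
complement of `Ω`. (Meant for `Ω` with nonempty complement.) -/
def IsJohnDomain {X : Type*} [MetricSpace X] (Ω : Set X) : Prop :=
  IsOpen Ω ∧ IsConnected Ω ∧ ∃ x₀ ∈ Ω, ∃ cJ : ℝ, 0 < cJ ∧ ∀ x ∈ Ω,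
    ∃ (l : ℝ) (c : ℝ → X), 0 ≤ l ∧ HasUnitSpeedOn c (Icc 0 l) ∧ c 0 = x ∧ c l = x₀ ∧
      ∀ t ∈ Icc 0 l, c t ∈ Ω ∧ t / cJ ≤ Metric.infDist (c t) Ωᶜ

/-- The truncated fractional seminorm `[u]_{W^{s,p}_τ(Ω, v)}`, where `d(y) = d(y, ∂Ω)`:
`( ∫_Ω ∫_{z ∈ Ω, d(z,y) ≤ τ d(y)} |u z - u y|^p v(z,y) / (μ(B(z,d(z,y))) d(z,y)^{sp}) dμ(z) dμ(y)
)^{1/p}`, as an extended nonnegative number. -/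
def truncatedSeminorm {X : Type*} [MetricSpace X] [MeasurableSpace X]
    (μ : Measure X) (Ω : Set X) (s p τ : ℝ) (v : X → X → ℝ) (u : X → ℝ) : ℝ≥0∞ :=
  (∫⁻ y in Ω, ∫⁻ z in Ω ∩ {z | dist z y ≤ τ * Metric.infDist y (frontier Ω)},
      ENNReal.ofReal (|u z - u y| ^ p * v z y) /
        (μ (Metric.ball z (dist z y)) * ENNReal.ofReal (dist z y ^ (s * p))) ∂μ ∂μ) ^ (1 / p)

/-- The measure `w dμ` on `Ω`, with the weight `w(x) = φ(d(x, F))`. -/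
def weightedMeasure {X : Type*} [MetricSpace X] [MeasurableSpace X]
    (μ : Measure X) (Ω F : Set X) (φ : ℝ → ℝ) : Measure X :=
  (μ.restrict Ω).withDensity fun x => ENNReal.ofReal (φ (Metric.infDist x F))

/-- The weight `v(x, y) = min_{z ∈ {x, y}} d(z, ∂Ω) ^ β * Φ(d(z, F))`. -/
def minWeight {X : Type*} [MetricSpace X] (Ω F : Set X) (Φ : ℝ → ℝ) (β : ℝ) (x y : X) : ℝ :=
  min (Metric.infDist x (frontier Ω) ^ β * Φ (Metric.infDist x F))
    (Metric.infDist y (frontier Ω) ^ β * Φ (Metric.infDist y F))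

end

/-! Write `q` for the exponent p*, `δ` for the distance to the complement of `Ω`, and `g` for the
`p`-th root of `localEnergy`. The proof is a chaining argument along John curves followed by
Hedberg's trick.

On the John curve of `x`, take the points at parameters `t_k = T (1 - ε)^k` and balls around them of
radius `ε t_k`, with `ε = τ / (6 J)`. The doubled balls are so far from the complement that any two
of their points form an admissible pair of the truncated energy, and each doubled ball contains the
next small ball. Hölder's inequality bounds consecutive differences of averages by `t_k^(s-n) ∫ g`
over the doubled ball. Where `g x` is finite the averages converge to `u x`. Telescoping thus bounds
`u x` minus one fixed average by a sum over scales (`exists_enorm_sub_setAverage_le`).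

On the `k`-th doubled ball `t_k ≤ C δ(y)`, and `w x ≤ C w y` by doubling of `φ`. Multiplying by
`w(x)^(1/q)` therefore replaces `g` by `G = δ^γ w^(1/q) g` at the cost of `t_k^(-γ)`. With `a = s -
γ` and `b = n/p - a`, each term is at most `t_k^a` times the maximal function `M` of `G` at `x`, and
at most `t_k^(-b)` times the `L^p` norm of `G`. Summing the minimum (`ENNReal.exists_tsum_min_le`)
gives `M^(p/q) ‖G‖_p^(1-p/q)`. The `q`-th power is integrated by the strong maximal theorem
(`exists_lintegral_maximalFn_rpow_le`), whose proof needs only the upper mass bound on `Ω`. Finally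
`exists_lintegral_weightedEnergy_le` compares `‖G‖_p` with the seminorm. -/

/-! ### Sums over geometric scales. -/

/-- Every positive finite number lies between two consecutive powers of `l < 1`. -/
lemma ENNReal.exists_zpow_le_lt {l t : ℝ≥0∞} (hl0 : l ≠ 0) (hl1 : l < 1) (ht0 : t ≠ 0)
    (ht : t ≠ ∞) : ∃ k : ℤ, l ^ k ≤ t ∧ t < l ^ (k - 1) := by
  obtain ⟨k, h1, h2⟩ := ENNReal.exists_mem_Ico_zpow ht0 ht (ENNReal.one_lt_inv.2 hl1)
    (ENNReal.inv_ne_top.2 hl0)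
  refine ⟨-k, by rwa [ENNReal.inv_zpow, ← ENNReal.zpow_neg] at h1, ?_⟩
  rw [ENNReal.inv_zpow, ← ENNReal.zpow_neg] at h2
  rwa [show -k - 1 = -(k + 1) by ring]

/-- A geometric series over all powers of `l` up to a threshold `t`. -/
lemma ENNReal.tsum_zpow_rpow_le {l : ℝ≥0∞} (hl0 : l ≠ 0) (hl1 : l < 1) {β : ℝ} (hβ : 0 < β)
    (t : ℝ≥0∞) :
    ∑' k : ℤ, (if l ^ k ≤ t then (l ^ k) ^ β else 0) ≤ (1 - l ^ β)⁻¹ * t ^ β := by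
  have hlt : l ≠ ∞ := (hl1.trans ENNReal.one_lt_top).ne
  rcases eq_or_ne t 0 with rfl | ht0
  · have : ∀ k : ℤ, (if l ^ k ≤ 0 then (l ^ k) ^ β else 0) = 0 := by
      intro k
      rw [if_neg]
      simpa using (ENNReal.zpow_pos hl0 hlt k).ne'
    rw [tsum_congr this]; simp
  rcases eq_or_ne t ∞ with rfl | ht
  · rw [ENNReal.top_rpow_of_pos hβ, ENNReal.mul_top]
    · exact le_top
    · simp
  obtain ⟨K, hK1, hK2⟩ := ENNReal.exists_zpow_le_lt hl0 hl1 ht0 ht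
  have hanti : ∀ i j : ℤ, i ≤ j → l ^ j ≤ l ^ i := by
    intro i j hij
    obtain ⟨m, rfl⟩ := Int.le.dest hij
    rw [ENNReal.zpow_add hl0 hlt, zpow_natCast]
    exact mul_le_of_le_one_right' (pow_le_one' hl1.le m)
  have hsupp : Function.support (fun k : ℤ => if l ^ k ≤ t then (l ^ k) ^ β else 0) ⊆
      range (fun j : ℕ => K + (j : ℤ)) := by
    intro k hk
    have hk' : l ^ k ≤ t := by
      by_contra h
      simp [h] at hk
    have : K ≤ k := by
      by_contra! h
      exact absurd ((hanti k (K - 1) (by omega)).trans hk') (not_le.2 hK2)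
    exact ⟨(k - K).toNat, by simp; omega⟩
  have hinj : Function.Injective (fun j : ℕ => K + (j : ℤ)) := fun i j h => by simpa using h
  rw [← hinj.tsum_eq hsupp]
  calc ∑' j : ℕ, (if l ^ (K + (j : ℤ)) ≤ t then (l ^ (K + (j : ℤ))) ^ β else 0)
      ≤ ∑' j : ℕ, (l ^ K) ^ β * (l ^ β) ^ j := by
        refine ENNReal.tsum_le_tsum fun j => ?_
        split_ifs
        · rw [ENNReal.zpow_add hl0 hlt, ENNReal.mul_rpow_of_nonneg _ _ hβ.le, zpow_natCast,
            ← ENNReal.rpow_natCast, ← ENNReal.rpow_natCast, ← ENNReal.rpow_mul,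
            ← ENNReal.rpow_mul, mul_comm β]
        · exact zero_le
    _ = (l ^ K) ^ β * (1 - l ^ β)⁻¹ := by rw [ENNReal.tsum_mul_left, ENNReal.tsum_geometric]
    _ ≤ (1 - l ^ β)⁻¹ * t ^ β := by
        rw [mul_comm]
        gcongr

lemma ENNReal.inv_one_sub_rpow_ne_top {l : ℝ≥0∞} (hl1 : l < 1) {β : ℝ} (hβ : 0 < β) :
    (1 - l ^ β)⁻¹ ≠ ∞ := by
  have : l ^ β < 1 := ENNReal.rpow_lt_one hl1 hβ
  exact ENNReal.inv_ne_top.2 (tsub_pos_of_lt this).ne'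

/-- Hedberg's splitting of a sum over a geometric sequence of scales. -/
lemma ENNReal.exists_tsum_min_le {l T : ℝ≥0∞} (hl0 : l ≠ 0) (hl1 : l < 1) (hT0 : T ≠ 0)
    (hT : T ≠ ∞) {a b : ℝ} (ha : 0 < a) (hb : 0 < b) :
    ∃ C : ℝ≥0∞, C ≠ ∞ ∧ ∀ M N : ℝ≥0∞,
      ∑' k : ℕ, min ((T * l ^ k) ^ a * M) ((T * l ^ k) ^ (-b) * N) ≤
        C * (M ^ (b / (a + b)) * N ^ (a / (a + b))) := by
  have hlt : l ≠ ∞ := (hl1.trans ENNReal.one_lt_top).ne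
  have hab : 0 < a + b := by positivity
  set Ca := (1 - l ^ a)⁻¹ with hCa
  set Cb := (1 - l ^ b)⁻¹ with hCb
  have hCb1 : 1 ≤ Cb := by
    rw [hCb, ENNReal.one_le_inv]; exact tsub_le_self
  refine ⟨Ca + Cb, ENNReal.add_ne_top.2 ⟨ENNReal.inv_one_sub_rpow_ne_top hl1 ha,
    ENNReal.inv_one_sub_rpow_ne_top hl1 hb⟩, fun M N => ?_⟩
  have hC0 : Ca + Cb ≠ 0 := by
    intro h
    have := (add_eq_zero.1 h).2
    simp [this] at hCb1
  rcases eq_or_ne M 0 with rfl | hM0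
  · simp
  rcases eq_or_ne N 0 with rfl | hN0
  · simp
  have hpM : M ^ (b / (a + b)) ≠ 0 := by
    simp [hM0, (div_pos hb hab).not_gt]
  have hpN : N ^ (a / (a + b)) ≠ 0 := by
    simp [hN0, (div_pos ha hab).not_gt]
  rcases eq_or_ne M ∞ with rfl | hM
  · rw [ENNReal.top_rpow_of_pos (div_pos hb hab), ENNReal.top_mul hpN, ENNReal.mul_top hC0]
    exact le_top
  rcases eq_or_ne N ∞ with rfl | hN
  · rw [ENNReal.top_rpow_of_pos (div_pos ha hab), ENNReal.mul_top hpM, ENNReal.mul_top hC0]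
    exact le_top
  -- `R` is the scale at which the two competing bounds `R ^ a * M` and `R ^ (-b) * N` coincide.
  set R : ℝ≥0∞ := (N / M) ^ (1 / (a + b)) with hR
  have hNM0 : N / M ≠ 0 := ENNReal.div_ne_zero.2 ⟨hN0, hM⟩
  have hNM : N / M ≠ ∞ := ENNReal.div_ne_top hN hM0
  have hR0 : R ≠ 0 := by rw [hR]; simp [hNM0, hNM]
  have hRt : R ≠ ∞ := by
    rw [hR]; exact ENNReal.rpow_ne_top_of_nonneg (by positivity) hNM
  have key1 : R ^ a * M = M ^ (b / (a + b)) * N ^ (a / (a + b)) := by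
    rw [hR, ← ENNReal.rpow_mul, ENNReal.div_rpow_of_nonneg _ _ (by positivity),
      show 1 / (a + b) * a = a / (a + b) by ring, div_eq_mul_inv, ← ENNReal.rpow_neg, mul_assoc,
      mul_comm]
    congr 1
    nth_rewrite 2 [← ENNReal.rpow_one M]
    rw [← ENNReal.rpow_add _ _ hM0 hM]
    congr 1
    field_simp
    ring
  have key2 : R ^ (-b) * N = M ^ (b / (a + b)) * N ^ (a / (a + b)) := by
    rw [ENNReal.rpow_neg, ← ENNReal.inv_rpow, hR, ← ENNReal.inv_rpow, ENNReal.inv_div (.inl hM) (.inl hM0),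
      ← ENNReal.rpow_mul, ENNReal.div_rpow_of_nonneg _ _ (by positivity),
      show 1 / (a + b) * b = b / (a + b) by ring, div_eq_mul_inv, ← ENNReal.rpow_neg, mul_assoc]
    congr 1
    nth_rewrite 2 [← ENNReal.rpow_one N]
    rw [← ENNReal.rpow_add _ _ hN0 hN]
    congr 1
    field_simp
    ring
  have hTl : ∀ k : ℕ, T * l ^ k ≠ 0 := fun k => mul_ne_zero hT0 (pow_ne_zero _ hl0)
  have hTlt : ∀ k : ℕ, T * l ^ k ≠ ∞ := fun k => ENNReal.mul_ne_top hT (ENNReal.pow_ne_top hlt)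
  -- Scales below `R` use the first bound, scales above it the second. Writing the latter through `l
  -- ^ (-k)` makes both halves geometric series up to a threshold.
  have hterm : ∀ k : ℕ, min ((T * l ^ k) ^ a * M) ((T * l ^ k) ^ (-b) * N) ≤
      T ^ a * M * (if l ^ (k : ℤ) ≤ R / T then (l ^ (k : ℤ)) ^ a else 0) +
      T ^ (-b) * N * (if l ^ (-k : ℤ) ≤ T / R then (l ^ (-k : ℤ)) ^ b else 0) := by
    intro k
    by_cases hk : T * l ^ k ≤ R
    · rw [if_pos]
      · refine (min_le_left _ _).trans (le_add_right ?_)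
        rw [ENNReal.mul_rpow_of_nonneg _ _ ha.le, zpow_natCast]
        ring_nf
        rfl
      · rw [zpow_natCast, ENNReal.le_div_iff_mul_le (.inl hT0) (.inl hT), mul_comm]
        exact hk
    · push Not at hk
      have : l ^ (-k : ℤ) ≤ T / R := by
        rw [ENNReal.zpow_neg, zpow_natCast, ENNReal.le_div_iff_mul_le (.inl hR0) (.inl hRt),
          mul_comm, ← div_eq_mul_inv]
        refine ENNReal.div_le_of_le_mul ?_
        exact hk.le
      rw [if_pos this]
      refine (min_le_right _ _).trans (le_add_left ?_)
      rw [ENNReal.mul_rpow_of_ne_top hT (ENNReal.pow_ne_top hlt), ENNReal.zpow_neg, zpow_natCast,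
        ENNReal.rpow_neg (l ^ k), ENNReal.inv_rpow]
      ring_nf
      rfl
  calc _ ≤ ∑' k : ℕ, (T ^ a * M * (if l ^ (k : ℤ) ≤ R / T then (l ^ (k : ℤ)) ^ a else 0) +
      T ^ (-b) * N * (if l ^ (-k : ℤ) ≤ T / R then (l ^ (-k : ℤ)) ^ b else 0)) :=
        ENNReal.tsum_le_tsum hterm
    _ = T ^ a * M * (∑' k : ℕ, if l ^ (k : ℤ) ≤ R / T then (l ^ (k : ℤ)) ^ a else 0) +
      T ^ (-b) * N * ∑' k : ℕ, (if l ^ (-k : ℤ) ≤ T / R then (l ^ (-k : ℤ)) ^ b else 0) := by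
        rw [ENNReal.tsum_add, ENNReal.tsum_mul_left, ENNReal.tsum_mul_left]
    _ ≤ T ^ a * M * (Ca * (R / T) ^ a) + T ^ (-b) * N * (Cb * (T / R) ^ b) := by
        gcongr
        · refine le_trans ?_ (ENNReal.tsum_zpow_rpow_le hl0 hl1 ha _)
          exact ENNReal.tsum_comp_le_tsum_of_injective (f := fun k : ℕ => (k : ℤ))
            Nat.cast_injective (fun k : ℤ => if l ^ k ≤ R / T then (l ^ k) ^ a else 0)
        · refine le_trans ?_ (ENNReal.tsum_zpow_rpow_le hl0 hl1 hb _)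
          exact ENNReal.tsum_comp_le_tsum_of_injective (f := fun k : ℕ => (-k : ℤ))
            (fun i j h => by simpa using h)
            (fun k : ℤ => if l ^ k ≤ T / R then (l ^ k) ^ b else 0)
    _ = Ca * (R ^ a * M) + Cb * (R ^ (-b) * N) := by
        have hTa0 : T ^ a ≠ 0 := by simp [hT0, hT]
        have hTat : T ^ a ≠ ∞ := ENNReal.rpow_ne_top_of_nonneg ha.le hT
        have hTb0 : T ^ b ≠ 0 := by simp [hT0, hT]
        have hTbt : T ^ b ≠ ∞ := ENNReal.rpow_ne_top_of_nonneg hb.le hT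
        rw [ENNReal.div_rpow_of_nonneg _ _ ha.le, ENNReal.div_rpow_of_nonneg _ _ hb.le,
          ENNReal.rpow_neg, ENNReal.rpow_neg, div_eq_mul_inv, div_eq_mul_inv]
        congr 1
        · calc _ = (T ^ a * (T ^ a)⁻¹) * (Ca * (R ^ a * M)) := by ring
            _ = _ := by rw [ENNReal.mul_inv_cancel hTa0 hTat, one_mul]
        · calc _ = (T ^ b * (T ^ b)⁻¹) * (Cb * ((R ^ b)⁻¹ * N)) := by ring
            _ = _ := by rw [ENNReal.mul_inv_cancel hTb0 hTbt, one_mul]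
    _ = (Ca + Cb) * (M ^ (b / (a + b)) * N ^ (a / (a + b))) := by
        rw [key1, key2]; ring

/-- Dyadic layer-cake bound. -/
lemma ENNReal.rpow_le_tsum_zpow {b : ℝ≥0∞} (hb0 : b ≠ 0) (hb : b ≠ ∞) {p : ℝ} (hp : 0 < p)
    (t : ℝ≥0∞) :
    t ^ p ≤ ∑' k : ℤ, if b * 2⁻¹ ^ k < t then (b * 2 * 2⁻¹ ^ k) ^ p else 0 := by
  have hl0 : (2⁻¹ : ℝ≥0∞) ≠ 0 := by simp
  have hl1 : (2⁻¹ : ℝ≥0∞) < 1 := by simp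
  -- Approximating `t` from below gives the strict inequality in the level condition and includes `t
  -- = ∞`.
  have main : ∀ s < t, s ^ p ≤ ∑' k : ℤ, if b * 2⁻¹ ^ k < t then (b * 2 * 2⁻¹ ^ k) ^ p else 0 := by
    intro s hs
    rcases eq_or_ne s 0 with rfl | hs0
    · simp [hp]
    obtain ⟨k, h1, h2⟩ := ENNReal.exists_zpow_le_lt hl0 hl1 (t := s / b)
      (ENNReal.div_ne_zero.2 ⟨hs0, hb⟩) (ENNReal.div_ne_top hs.ne_top hb0)
    have h3 : b * 2⁻¹ ^ k < t := by
      rw [ENNReal.le_div_iff_mul_le (.inl hb0) (.inl hb), mul_comm] at h1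
      exact h1.trans_lt hs
    refine le_trans ?_ (ENNReal.le_tsum k)
    rw [if_pos h3]
    gcongr
    rw [ENNReal.div_lt_iff (.inl hb0) (.inl hb)] at h2
    refine h2.le.trans (le_of_eq ?_)
    rw [sub_eq_add_neg, ENNReal.zpow_add hl0 (by simp), zpow_neg_one, inv_inv]
    ring
  rw [← ENNReal.le_rpow_inv_iff hp]
  refine le_of_forall_lt fun s hs => ?_
  obtain ⟨r, hr1, hr2⟩ := exists_between hs
  exact hr1.trans_le ((ENNReal.le_rpow_inv_iff hp).2 (main r hr2))

/-! ### The Hardy–Littlewood maximal theorem under an upper mass bound. -/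

/-- The centred maximal function of `G`, normalized by `r ^ n`, over radii at most `R`. -/
noncomputable def maximalFn {X : Type*} [PseudoMetricSpace X] [MeasurableSpace X] (ν : Measure X)
    (n R : ℝ) (G : X → ℝ≥0∞) (x : X) : ℝ≥0∞ :=
  ⨆ r ∈ Ioc 0 R, (∫⁻ y in Metric.closedBall x r, G y ∂ν) / ENNReal.ofReal (r ^ n)

section maximal

variable {X : Type*} [PseudoMetricSpace X] [MeasurableSpace X]
  {ν : Measure X} {n A R : ℝ}

lemma setLIntegral_closedBall_le_maximalFn {G : X → ℝ≥0∞} {x : X} {r : ℝ} (hr : r ∈ Ioc 0 R) :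
    ∫⁻ y in Metric.closedBall x r, G y ∂ν ≤ ENNReal.ofReal (r ^ n) * maximalFn ν n R G x := by
  have h0 : 0 < r ^ n := Real.rpow_pos_of_pos hr.1 n
  rw [mul_comm, ← ENNReal.div_le_iff_le_mul (.inl (by simpa using h0)) (.inl (by simp))]
  exact le_iSup₂_of_le r hr le_rfl

/-- The weak type estimate for the maximal function. -/
lemma mul_measure_lt_maximalFn_le [OpensMeasurableSpace X] [SFinite ν]
    (hν : ∀ x r, 0 < r → ν (Metric.closedBall x r) ≤ ENNReal.ofReal (A * r ^ n))
    (G : X → ℝ≥0∞) {t : ℝ≥0∞} (ht0 : t ≠ 0) :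
    t * ν {x | t < maximalFn ν n R G x} ≤ ENNReal.ofReal (A * 5 ^ n) * ∫⁻ y, G y ∂ν := by
  rcases eq_or_ne t ∞ with rfl | ht
  · simp
  set E := {x | t < maximalFn ν n R G x} with hE
  have hex : ∀ x ∈ E, ∃ r ∈ Ioc 0 R,
      t * ENNReal.ofReal (r ^ n) < ∫⁻ y in Metric.closedBall x r, G y ∂ν := by
    intro x hx
    simp only [hE, mem_ofPred_eq, maximalFn, lt_iSup_iff] at hx
    obtain ⟨r, hr, h⟩ := hx
    exact ⟨r, hr, (ENNReal.lt_div_iff_mul_lt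
      (.inl (by simpa using Real.rpow_pos_of_pos hr.1 n)) (.inl (by simp))).1 h⟩
  choose! r hr hlt using hex
  obtain ⟨v, hvE, hdisj, hcov⟩ := Vitali.exists_disjoint_subfamily_covering_enlargement_closedBall
    E id r R (fun a ha => (hr a ha).2) 5 (by norm_num)
  simp only [id] at hdisj hcov
  -- Without separability of `X`, countability comes from mass: the disjoint balls all have positive
  -- measure for an s-finite measure. `G` need not be measurable, so its density is replaced by a
  -- measurable minorant with the same integrals over all sets.
  have hcount : v.Countable := by
    have hd : Pairwise (Function.onFun Disjoint fun i : v => Metric.closedBall (i : X) (r i)) :=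
      fun i j hij => hdisj i.2 j.2 (fun h => hij (Subtype.ext h))
    have hlarge : ∀ i : v, 0 < ∫⁻ y in Metric.closedBall (i : X) (r i), G y ∂ν := fun i =>
      (zero_le).trans_lt (hlt i (hvE i.2))
    obtain ⟨G', hG'm, -, hG'⟩ := exists_measurable_le_forall_setLIntegral_eq ν G
    have := Measure.countable_meas_pos_of_disjoint_iUnion (μ := ν.withDensity G')
      (As := fun i : v => Metric.closedBall (i : X) (r i))
      (fun i => Metric.isClosed_closedBall.measurableSet) hd
    have huniv : {i : v | 0 < ν.withDensity G' (Metric.closedBall (i : X) (r i))} = univ := by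
      ext i
      simp only [mem_ofPred_eq, mem_univ, iff_true]
      rw [withDensity_apply _ Metric.isClosed_closedBall.measurableSet, ← hG']
      exact hlarge i
    rw [huniv] at this
    exact countable_coe_iff.1 (countable_univ_iff.1 this)
  have hsub : E ⊆ ⋃ b ∈ v, Metric.closedBall b (5 * r b) := by
    intro x hx
    obtain ⟨b, hb, h⟩ := hcov x hx
    exact mem_biUnion hb (h (Metric.mem_closedBall_self (hr x hx).1.le))
  have : Countable v := hcount.to_subtype
  calc t * ν E ≤ t * ∑' b : v, ν (Metric.closedBall (b : X) (5 * r b)) := by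
        gcongr
        exact (measure_mono hsub).trans (measure_biUnion_le ν hcount _)
    _ ≤ t * ∑' b : v, ENNReal.ofReal (A * 5 ^ n) * ENNReal.ofReal (r b ^ n) := by
        gcongr with b
        have hb := (hr b (hvE b.2)).1
        refine (hν _ _ (by positivity)).trans (le_of_eq ?_)
        rw [Real.mul_rpow (by norm_num) hb.le, ← mul_assoc,
          ENNReal.ofReal_mul' (Real.rpow_nonneg hb.le n)]
    _ = ENNReal.ofReal (A * 5 ^ n) * ∑' b : v, t * ENNReal.ofReal (r b ^ n) := by
        rw [ENNReal.tsum_mul_left, ENNReal.tsum_mul_left]; ring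
    _ ≤ ENNReal.ofReal (A * 5 ^ n) *
          ∑' b : v, ∫⁻ y in Metric.closedBall (b : X) (r b), G y ∂ν := by
        gcongr with b
        exact (hlt b (hvE b.2)).le
    _ = ENNReal.ofReal (A * 5 ^ n) *
          ∫⁻ y in ⋃ b ∈ v, Metric.closedBall (b : X) (r b), G y ∂ν := by
        rw [lintegral_biUnion hcount (fun b _ => Metric.isClosed_closedBall.measurableSet) hdisj]
    _ ≤ _ := by
        gcongr
        exact Measure.restrict_le_self

/-- The maximal function of a sum of a large part and of a part bounded by `t`. -/
lemma maximalFn_le_add (hA : 0 ≤ A)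
    (hν : ∀ x r, 0 < r → ν (Metric.closedBall x r) ≤ ENNReal.ofReal (A * r ^ n))
    (G : X → ℝ≥0∞) (hG : Measurable G) (t : ℝ≥0∞) (x : X) :
    maximalFn ν n R G x ≤
      maximalFn ν n R ({y | t < G y}.indicator G) x + ENNReal.ofReal A * t := by
  refine iSup₂_le fun r hr => ?_
  have h0 : 0 < r ^ n := Real.rpow_pos_of_pos hr.1 n
  have hS : MeasurableSet {y | t < G y} := measurableSet_lt measurable_const hG
  calc (∫⁻ y in Metric.closedBall x r, G y ∂ν) / ENNReal.ofReal (r ^ n)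
      ≤ (∫⁻ y in Metric.closedBall x r, ({y | t < G y}.indicator G y + t) ∂ν)
          / ENNReal.ofReal (r ^ n) := by
        gcongr with y
        by_cases hy : t < G y
        · rw [indicator_of_mem (by exact hy)]; exact le_self_add
        · exact le_add_left (not_lt.1 hy)
    _ = (∫⁻ y in Metric.closedBall x r, {y | t < G y}.indicator G y ∂ν) / ENNReal.ofReal (r ^ n)
          + t * ν (Metric.closedBall x r) / ENNReal.ofReal (r ^ n) := by
        rw [lintegral_add_left (hG.indicator hS), ENNReal.add_div, setLIntegral_const]
    _ ≤ _ := by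
        gcongr
        · exact le_iSup₂_of_le r hr le_rfl
        · rw [ENNReal.div_le_iff_le_mul (.inl (by simpa using h0)) (.inl (by simp)),
            mul_comm _ t, mul_assoc, ← ENNReal.ofReal_mul hA]
          gcongr
          exact hν x r hr.1

/-- The strong type estimate for the maximal function. -/
theorem exists_lintegral_maximalFn_rpow_le [OpensMeasurableSpace X] [SFinite ν] (hA : 0 ≤ A)
    (hν : ∀ x r, 0 < r → ν (Metric.closedBall x r) ≤ ENNReal.ofReal (A * r ^ n))
    {p : ℝ} (hp : 1 < p) :
    ∃ C : ℝ≥0∞, C ≠ ∞ ∧ ∀ G : X → ℝ≥0∞, Measurable G →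
      ∫⁻ x, maximalFn ν n R G x ^ p ∂ν ≤ C * ∫⁻ x, G x ^ p ∂ν := by
  have hp0 : 0 < p := by linarith
  set l : ℝ≥0∞ := 2⁻¹ with hl
  have hl0 : l ≠ 0 := by simp [hl]
  have hl1 : l < 1 := by simp [hl]
  have hlt : l ≠ ∞ := by simp [hl]
  -- The part of `G` below `t` contributes at most `A t` to the maximal function, so exceeding `(1 +
  -- A) t` forces the part above `t` to contribute more than `t`.
  set b : ℝ≥0∞ := 1 + ENNReal.ofReal A with hb
  have hb0 : b ≠ 0 := by simp [hb]
  have hbt : b ≠ ∞ := by simp [hb]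
  set W : ℝ≥0∞ := ENNReal.ofReal (A * 5 ^ n) with hW
  refine ⟨(b * 2) ^ p * W * (1 - l ^ (p - 1))⁻¹, ?_, fun G hG => ?_⟩
  · exact ENNReal.mul_ne_top (ENNReal.mul_ne_top (ENNReal.rpow_ne_top_of_nonneg hp0.le
      (ENNReal.mul_ne_top hbt (by simp))) (by simp [hW]))
      (ENNReal.inv_one_sub_rpow_ne_top hl1 (by linarith))
  have hS : ∀ t, MeasurableSet {y | t < G y} := fun t => measurableSet_lt measurable_const hG
  set E : ℤ → Set X := fun k => {x | b * l ^ k < maximalFn ν n R G x} with hE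
  have hlk0 : ∀ k : ℤ, l ^ k ≠ 0 := fun k => (ENNReal.zpow_pos hl0 hlt k).ne'
  have hlkt : ∀ k : ℤ, l ^ k ≠ ∞ := fun k => (ENNReal.zpow_lt_top hl0 hlt k).ne
  have hEle : ∀ k : ℤ, l ^ k * ν (E k) ≤ W * ∫⁻ y, {y | l ^ k < G y}.indicator G y ∂ν := by
    intro k
    refine le_trans ?_ (mul_measure_lt_maximalFn_le (R := R) hν ({y | l ^ k < G y}.indicator G)
      (hlk0 k))
    gcongr
    intro x hx
    have h1 : b * l ^ k < maximalFn ν n R G x := hx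
    have h2 := h1.trans_le (maximalFn_le_add hA hν G hG (l ^ k) x)
    rw [hb, add_mul, one_mul] at h2
    exact lt_of_add_lt_add_right h2
  -- Marcinkiewicz interpolation over dyadic levels. The level sets `E k` are not shown to be
  -- measurable, hence the measurable hulls.
  calc ∫⁻ x, maximalFn ν n R G x ^ p ∂ν
      ≤ ∫⁻ x, ∑' k : ℤ, (toMeasurable ν (E k)).indicator (fun _ => (b * 2 * l ^ k) ^ p) x ∂ν := by
        refine lintegral_mono fun x => ?_
        refine (ENNReal.rpow_le_tsum_zpow hb0 hbt hp0 _).trans (ENNReal.tsum_le_tsum fun k => ?_)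
        split_ifs with h
        · have hx : x ∈ E k := h
          rw [indicator_of_mem (subset_toMeasurable _ _ hx)]
        · exact zero_le
    _ = ∑' k : ℤ, (b * 2 * l ^ k) ^ p * ν (E k) := by
        rw [lintegral_tsum fun k =>
          (measurable_const.indicator (measurableSet_toMeasurable _ _)).aemeasurable]
        congr 1 with k
        rw [lintegral_indicator_const (measurableSet_toMeasurable _ _), measure_toMeasurable]
    _ ≤ ∑' k : ℤ, ∫⁻ y, (b * 2) ^ p * W *
          ((l ^ k) ^ (p - 1) * {y | l ^ k < G y}.indicator G y) ∂ν := by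
        refine ENNReal.tsum_le_tsum fun k => ?_
        have hm : Measurable fun y => {y | l ^ k < G y}.indicator G y := hG.indicator (hS _)
        rw [lintegral_const_mul _ (hm.const_mul _), lintegral_const_mul _ hm]
        calc (b * 2 * l ^ k) ^ p * ν (E k)
            = (b * 2) ^ p * (l ^ k) ^ (p - 1) * (l ^ k * ν (E k)) := by
              rw [ENNReal.mul_rpow_of_nonneg _ _ hp0.le]
              conv_lhs => rw [show p = (p - 1) + 1 by ring, ENNReal.rpow_add _ _ (hlk0 k) (hlkt k),
                ENNReal.rpow_one]
              ring_nf
          _ ≤ (b * 2) ^ p * (l ^ k) ^ (p - 1) *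
                (W * ∫⁻ y, {y | l ^ k < G y}.indicator G y ∂ν) := mul_le_mul_right (hEle k) _
          _ = _ := by ring
    _ = ∫⁻ y, (b * 2) ^ p * W *
          ∑' k : ℤ, ((l ^ k) ^ (p - 1) * {y | l ^ k < G y}.indicator G y) ∂ν := by
        rw [← lintegral_tsum fun k => (((hG.indicator (hS _)).const_mul _).const_mul _).aemeasurable]
        simp_rw [ENNReal.tsum_mul_left]
    _ ≤ ∫⁻ y, (b * 2) ^ p * W * (1 - l ^ (p - 1))⁻¹ * G y ^ p ∂ν := by
        refine lintegral_mono fun y => ?_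
        dsimp only
        rw [mul_assoc _ _ (G y ^ p)]
        gcongr
        rcases eq_or_ne (G y) 0 with h0 | h0
        · have : ∀ k : ℤ, {y | l ^ k < G y}.indicator G y = 0 := fun k =>
            indicator_apply_eq_zero.2 fun _ => h0
          simp [this]
        calc ∑' k : ℤ, ((l ^ k) ^ (p - 1) * {y | l ^ k < G y}.indicator G y)
            ≤ ∑' k : ℤ, G y * (if l ^ k ≤ G y then (l ^ k) ^ (p - 1) else 0) := by
              refine ENNReal.tsum_le_tsum fun k => ?_
              by_cases h : l ^ k < G y
              · rw [indicator_of_mem (by exact h), if_pos h.le, mul_comm]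
              · rw [indicator_of_notMem (by exact h), mul_zero]
                exact zero_le
          _ ≤ G y * ((1 - l ^ (p - 1))⁻¹ * G y ^ (p - 1)) := by
              rw [ENNReal.tsum_mul_left]
              gcongr
              exact ENNReal.tsum_zpow_rpow_le hl0 hl1 (by linarith) _
          _ = (1 - l ^ (p - 1))⁻¹ * G y ^ p := by
              rw [mul_left_comm]
              congr 1
              rcases eq_or_ne (G y) ∞ with ht | ht
              · rw [ht, ENNReal.top_rpow_of_pos (by linarith), ENNReal.top_rpow_of_pos hp0]
                simp
              · conv_rhs => rw [show p = 1 + (p - 1) by ring, ENNReal.rpow_add _ _ h0 ht,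
                  ENNReal.rpow_one]
    _ = _ := by rw [lintegral_const_mul _ (hG.pow_const p)]

end maximal

/-! ### John curves, finite coverings and mass bounds on the domain. -/

/-- The John condition with curves that all have the same parameter interval `[0, T]`, being
constant near its end. -/
lemma IsJohnDomain.exists_curves {X : Type*} [MetricSpace X] {Ω : Set X} (hΩ : IsJohnDomain Ω)
    (hne : Ωᶜ.Nonempty) :
    ∃ (x₀ : X) (J T : ℝ) (c : X → ℝ → X), 1 ≤ J ∧ 0 < T ∧ ∀ x ∈ Ω, c x 0 = x ∧ c x T = x₀ ∧
      (∀ t ∈ Icc 0 T, ∀ t' ∈ Icc 0 T, dist (c x t) (c x t') ≤ |t - t'|) ∧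
      ∀ t ∈ Icc 0 T, c x t ∈ Ω ∧ t / J ≤ Metric.infDist (c x t) Ωᶜ := by
  obtain ⟨hop, -, x₀, hx₀, cJ, hcJ, h⟩ := hΩ
  have hpos : 0 < Metric.infDist x₀ Ωᶜ :=
    (hop.isClosed_compl.notMem_iff_infDist_pos hne).1 (by simpa using hx₀)
  set J := max cJ 1 with hJ
  have hJ1 : 1 ≤ J := le_max_right _ _
  have hcJJ : cJ ≤ J := le_max_left _ _
  have hJ0 : 0 < J := by linarith
  choose! l c hl hspeed h0 hl0 hc using h
  -- The John condition at the endpoint `x₀` gives `l x ≤ cJ * infDist x₀ Ωᶜ`, so every curve fits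
  -- into `[0, T]`. The choice of `T` also keeps the condition true on the stretch where the curve
  -- rests at `x₀`.
  refine ⟨x₀, J, J * Metric.infDist x₀ Ωᶜ, fun x t => c x (min t (l x)), hJ1, by positivity,
    fun x hx => ?_⟩
  have hlT : l x ≤ J * Metric.infDist x₀ Ωᶜ := by
    have := (hc x hx (l x) ⟨hl x hx, le_rfl⟩).2
    rw [hl0 x hx, div_le_iff₀ hcJ] at this
    nlinarith
  have hmem : ∀ t ∈ Icc 0 (J * Metric.infDist x₀ Ωᶜ), min t (l x) ∈ Icc 0 (l x) :=
    fun t ht => ⟨le_min ht.1 (hl x hx), min_le_right _ _⟩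
  have hlip : ∀ t ∈ Icc 0 (l x), ∀ t' ∈ Icc 0 (l x), t ≤ t' →
      dist (c x t) (c x t') ≤ t' - t := by
    intro t ht t' ht' htt
    have h1 := hspeed x hx ht ht'
    have h2 : edist (c x t) (c x t') ≤ eVariationOn (c x) (Icc 0 (l x) ∩ Icc t t') :=
      eVariationOn.edist_le _ ⟨ht, le_rfl, htt⟩ ⟨ht', htt, le_rfl⟩
    rw [h1, edist_dist] at h2
    simpa using (ENNReal.ofReal_le_ofReal_iff (by simpa using htt)).1 h2
  refine ⟨by simp [hl x hx, h0 x hx], by simp [hlT, hl0 x hx], fun t ht t' ht' => ?_,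
    fun t ht => ⟨(hc x hx _ (hmem t ht)).1, ?_⟩⟩
  · have key : |min t (l x) - min t' (l x)| ≤ |t - t'| := by
      have := abs_min_sub_min_le_max t (l x) t' (l x)
      simpa using this
    refine le_trans ?_ key
    rcases le_total (min t (l x)) (min t' (l x)) with hle | hle
    · rw [abs_sub_comm, abs_of_nonneg (by linarith)]
      exact hlip _ (hmem t ht) _ (hmem t' ht') hle
    · rw [dist_comm, abs_of_nonneg (by linarith)]
      exact hlip _ (hmem t' ht') _ (hmem t ht) hle
  · change t / J ≤ Metric.infDist (c x (min t (l x))) Ωᶜ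
    rcases le_total t (l x) with hle | hle
    · rw [min_eq_left hle]
      exact (div_le_div_of_nonneg_left ht.1 hcJ hcJJ).trans (hc x hx t ⟨ht.1, hle⟩).2
    · rw [min_eq_right hle, hl0 x hx, div_le_iff₀ hJ0, mul_comm]
      exact ht.2

lemma ofReal_lt_ediam_of_lt_infDist {X : Type*} [MetricSpace X] {s : Set X} (hne : s.Nonempty)
    {x : X} {r : ℝ} (hr : 0 ≤ r) (h : r < Metric.infDist x s) :
    ENNReal.ofReal r < Metric.ediam (univ : Set X) := by
  obtain ⟨w, hw⟩ := hne
  have h1 : r < dist x w := h.trans_le (Metric.infDist_le_dist_of_mem hw)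
  calc ENNReal.ofReal r < ENNReal.ofReal (dist x w) :=
        (ENNReal.ofReal_lt_ofReal_iff (by linarith)).2 h1
    _ = edist x w := (edist_dist _ _).symm
    _ ≤ _ := Metric.edist_le_ediam_of_mem (mem_univ _) (mem_univ _)

section cover

variable {X : Type*} [MetricSpace X] [MeasurableSpace X] [BorelSpace X] {μ : Measure X} {n : ℝ}

/-- In an Ahlfors regular space, a ball is covered by finitely many balls of a third of its
radius. -/
lemma IsAhlforsRegular.exists_finite_cover_ball (hμ : IsAhlforsRegular μ n) {η : ℝ} (hη : 0 < η)
    (hD : ENNReal.ofReal (4 * η) < Metric.ediam (univ : Set X)) (z : X) :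
    ∃ t : Set X, t.Finite ∧ Metric.ball z (3 * η) ⊆ ⋃ y ∈ t, Metric.ball y η := by
  obtain ⟨cl, cu, hcl, -, h⟩ := hμ
  -- Disjoint balls of radius `η / 10` inside `ball z (4 * η)` have mass bounded below, so there are
  -- finitely many; enlarging them five times gives radius `η / 2 < η`.
  obtain ⟨v, hv, hdisj, hcov⟩ := Vitali.exists_disjoint_subfamily_covering_enlargement_closedBall
    (Metric.ball z (3 * η)) id (fun _ => η / 10) (η / 10) (fun _ _ => le_rfl) 5 (by norm_num)
  simp only [id] at hdisj hcov
  refine ⟨v, ?_, fun y hy => ?_⟩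
  · have hfin : {i : v | ENNReal.ofReal (cl * (η / 10) ^ n) ≤
        μ (Metric.closedBall (i : X) (η / 10))}.Finite := by
      refine Measure.finite_const_le_meas_of_disjoint_iUnion μ ?_
        (fun i => Metric.isClosed_closedBall.measurableSet)
        (fun i j hij => hdisj i.2 j.2 fun h => hij (Subtype.ext h)) ?_
      · rw [ENNReal.ofReal_pos]; positivity
      · refine ne_top_of_le_ne_top ?_ (measure_mono (t := Metric.ball z (4 * η)) ?_)
        · exact ne_top_of_le_ne_top ENNReal.ofReal_ne_top (h z _ (by positivity) hD).2
        · refine iUnion_subset fun i y hy => ?_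
          have h1 : dist (i : X) z < 3 * η := hv i.2
          have h2 : dist y i ≤ η / 10 := hy
          rw [Metric.mem_ball]
          linarith [dist_triangle y i z]
    have huniv : {i : v | ENNReal.ofReal (cl * (η / 10) ^ n) ≤
        μ (Metric.closedBall (i : X) (η / 10))} = univ := by
      refine eq_univ_of_forall fun i => ?_
      refine (h i _ (by positivity) (lt_of_le_of_lt ?_ hD)).1.trans
        (measure_mono Metric.ball_subset_closedBall)
      exact ENNReal.ofReal_le_ofReal (by linarith)
    rw [huniv] at hfin
    exact finite_coe_iff.1 (finite_univ_iff.1 hfin)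
  · obtain ⟨b, hb, hsub⟩ := hcov y hy
    have := hsub (Metric.mem_closedBall_self (by positivity))
    refine mem_biUnion hb ?_
    rw [Metric.mem_closedBall] at this
    rw [Metric.mem_ball]
    linarith

variable {Ω : Set X} {x₀ : X} {T : ℝ} {c : X → ℝ → X}

/-- A set whose points are joined to a fixed point by curves of uniformly bounded length is covered
by finitely many small balls. -/
lemma IsAhlforsRegular.exists_finite_cover (hμ : IsAhlforsRegular μ n) (hT : 0 < T)
    (hc0 : ∀ x ∈ Ω, c x 0 = x) (hcT : ∀ x ∈ Ω, c x T = x₀)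
    (hc : ∀ x ∈ Ω, ∀ t ∈ Icc 0 T, ∀ t' ∈ Icc 0 T, dist (c x t) (c x t') ≤ |t - t'|)
    {η : ℝ} (hη : 0 < η) (hD : ENNReal.ofReal (4 * η) < Metric.ediam (univ : Set X)) :
    ∃ t : Set X, t.Finite ∧ Ω ⊆ ⋃ y ∈ t, Metric.ball y η := by
  -- All curves end at `x₀`. Walking back by `η` moves each point by at most `η`, and each enlarged
  -- ball is covered again by finitely many small ones. Only radii below the diameter are used,
  -- where regularity applies.
  have step : ∀ k : ℕ, ∃ t : Set X, t.Finite ∧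
      ∀ x ∈ Ω, c x (max 0 (T - k * η)) ∈ ⋃ y ∈ t, Metric.ball y η := by
    intro k
    induction k with
    | zero =>
      refine ⟨{x₀}, finite_singleton _, fun x hx => ?_⟩
      simp [hT.le, hcT x hx, hη]
    | succ k ih =>
      obtain ⟨t, ht, h⟩ := ih
      choose f hf hcov using fun z : X => hμ.exists_finite_cover_ball hη hD z
      refine ⟨⋃ y ∈ t, f y, ht.biUnion fun y _ => hf y, fun x hx => ?_⟩
      obtain ⟨y, hy, hxy⟩ := mem_iUnion₂.1 (h x hx)
      have hk : 0 ≤ (k : ℝ) * η := by positivity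
      have hd : dist (c x (max 0 (T - (k + 1 : ℕ) * η))) (c x (max 0 (T - k * η))) ≤ η := by
        refine (hc x hx _ ?_ _ ?_).trans ?_
        · exact ⟨le_max_left _ _, max_le hT.le (by push_cast; nlinarith)⟩
        · exact ⟨le_max_left _ _, max_le hT.le (by linarith)⟩
        · refine (abs_max_sub_max_le_max _ _ _ _).trans ?_
          push_cast
          rw [show T - (k + 1) * η - (T - k * η) = -η by ring]
          simp [abs_of_pos hη, hη.le]
      have hin : c x (max 0 (T - (k + 1 : ℕ) * η)) ∈ Metric.ball y (3 * η) := by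
        rw [Metric.mem_ball] at hxy ⊢
        linarith [dist_triangle (c x (max 0 (T - (k + 1 : ℕ) * η))) (c x (max 0 (T - k * η))) y]
      obtain ⟨w, hw, hxw⟩ := mem_iUnion₂.1 (hcov y hin)
      exact mem_biUnion (mem_biUnion hy hw) hxw
  obtain ⟨k, hk⟩ := exists_nat_ge (T / η)
  obtain ⟨t, ht, h⟩ := step k
  refine ⟨t, ht, fun x hx => ?_⟩
  have := h x hx
  rw [div_le_iff₀ hη] at hk
  rwa [max_eq_left (by linarith), hc0 x hx] at this

/-- Such a set is separable, has finite measure, and satisfies an upper mass bound at all scales. -/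
lemma IsAhlforsRegular.exists_measure_inter_closedBall_le (hμ : IsAhlforsRegular μ n) (hn : 0 < n)
    (hD0 : Metric.ediam (univ : Set X) ≠ 0) (hT : 0 < T)
    (hc0 : ∀ x ∈ Ω, c x 0 = x) (hcT : ∀ x ∈ Ω, c x T = x₀)
    (hc : ∀ x ∈ Ω, ∀ t ∈ Icc 0 T, ∀ t' ∈ Icc 0 T, dist (c x t) (c x t') ≤ |t - t'|) :
    TopologicalSpace.IsSeparable Ω ∧ μ Ω < ∞ ∧ ∃ A : ℝ, 0 < A ∧ ∀ x r, 0 < r →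
      μ.restrict Ω (Metric.closedBall x r) ≤ ENNReal.ofReal (A * r ^ n) := by
  obtain ⟨η, hη, hD⟩ : ∃ η : ℝ, 0 < η ∧ ENNReal.ofReal (4 * η) < Metric.ediam (univ : Set X) := by
    obtain ⟨e, he0, he⟩ := exists_between (pos_iff_ne_zero.2 hD0)
    have het : e ≠ ∞ := he.ne_top
    refine ⟨e.toReal / 4, div_pos (ENNReal.toReal_pos he0.ne' het) (by norm_num), ?_⟩
    rwa [mul_div_cancel₀ _ (by norm_num), ENNReal.ofReal_toReal het]
  have hmono : ∀ r : ℝ, r ≤ 4 * η → ENNReal.ofReal r < Metric.ediam (univ : Set X) := fun r hr =>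
    (ENNReal.ofReal_le_ofReal hr).trans_lt hD
  have htb : TotallyBounded Ω := by
    refine Metric.totallyBounded_iff.2 fun ε hε => ?_
    obtain ⟨t, ht, h⟩ := hμ.exists_finite_cover hT hc0 hcT hc (lt_min hε hη)
      (hmono _ (by linarith [min_le_right ε η]))
    refine ⟨t, ht, h.trans (iUnion₂_mono fun y _ => Metric.ball_subset_ball (min_le_left _ _))⟩
  have hfin : μ Ω < ∞ := by
    obtain ⟨t, ht, h⟩ := hμ.exists_finite_cover hT hc0 hcT hc hη hD
    obtain ⟨cl, cu, -, -, hr⟩ := hμ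
    refine (measure_mono h).trans_lt (measure_biUnion_lt_top ht fun y _ => ?_)
    exact (hr y η hη (hmono _ (by linarith))).2.trans_lt ENNReal.ofReal_lt_top
  refine ⟨htb.isSeparable, hfin, ?_⟩
  obtain ⟨cl, cu, -, hcu, hr⟩ := hμ
  -- For `r ≤ η` regularity is applied to `ball x (2 * r)`; for larger `r` the total mass of `Ω`
  -- suffices.
  refine ⟨max (cu * 2 ^ n) ((μ Ω).toReal / η ^ n), by positivity, fun x r hr0 => ?_⟩
  have hrn : 0 < r ^ n := Real.rpow_pos_of_pos hr0 n
  have hηn : 0 < η ^ n := Real.rpow_pos_of_pos hη n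
  rcases le_or_gt r η with hle | hlt
  · calc μ.restrict Ω (Metric.closedBall x r) ≤ μ (Metric.ball x (2 * r)) :=
          (Measure.restrict_apply_le _ _).trans
            (measure_mono (Metric.closedBall_subset_ball (by linarith)))
      _ ≤ ENNReal.ofReal (cu * (2 * r) ^ n) :=
          (hr x _ (by linarith) (hmono _ (by linarith))).2
      _ ≤ _ := by
          rw [Real.mul_rpow (by norm_num) hr0.le, ← mul_assoc]
          gcongr
          exact le_max_left _ _
  · calc μ.restrict Ω (Metric.closedBall x r) ≤ μ Ω := by
          exact (measure_mono (subset_univ _)).trans (Measure.restrict_apply_univ Ω).le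
      _ = ENNReal.ofReal (μ Ω).toReal := (ENNReal.ofReal_toReal hfin.ne).symm
      _ ≤ ENNReal.ofReal ((μ Ω).toReal / η ^ n * r ^ n) := by
          refine ENNReal.ofReal_le_ofReal ?_
          rw [div_mul_eq_mul_div, le_div_iff₀ hηn]
          gcongr
      _ ≤ _ := by
          gcongr
          exact le_max_right _ _

end cover

/-! ### Local energy and mean values. -/

/-- On a separable set the distance agrees with a function that is measurable for the product
σ-algebra. -/
lemma TopologicalSpace.IsSeparable.exists_measurable_eq_edist {X : Type*} [MetricSpace X]
    [MeasurableSpace X] [OpensMeasurableSpace X] {Ω : Set X}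
    (hΩ : TopologicalSpace.IsSeparable Ω) :
    ∃ D : X × X → ℝ≥0∞, Measurable D ∧ ∀ x ∈ Ω, ∀ y, D (x, y) = edist x y := by
  obtain ⟨S, hS, hsub⟩ := hΩ
  refine ⟨fun q => ⨅ a ∈ S, (edist q.1 a + edist a q.2), ?_, fun x hx y => ?_⟩
  · refine Measurable.biInf _ hS fun a _ => ?_
    exact ((continuous_id.edist continuous_const).measurable.comp measurable_fst).add
      ((continuous_const.edist continuous_id).measurable.comp measurable_snd)
  · refine le_antisymm ?_ (le_iInf₂ fun a _ => edist_triangle _ _ _)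
    refine ENNReal.le_of_forall_pos_le_add fun ε hε _ => ?_
    obtain ⟨a, ha, hxa⟩ := EMetric.mem_closure_iff.1 (hsub hx) (ε / 2)
      (by simpa using hε.ne')
    refine (iInf₂_le a ha).trans ?_
    calc edist x a + edist a y ≤ edist x a + (edist a x + edist x y) := by
          gcongr; exact edist_triangle _ _ _
      _ ≤ ε / 2 + (ε / 2 + edist x y) := by
          rw [edist_comm a x]; gcongr
      _ = edist x y + ε := by
          rw [← add_assoc, ENNReal.add_halves, add_comm]

/-- The density `∫ |u z - u y| ^ p / d(z, y) ^ (n + s p) dμ(z)` at `y` of the truncated fractional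
energy, where `z` ranges over the points of `Ω` with `d(z, y) ≤ τ d(y, Ωᶜ)`. -/
noncomputable def localEnergy {X : Type*} [MetricSpace X] [MeasurableSpace X] (μ : Measure X)
    (Ω : Set X) (n s p τ : ℝ) (u : X → ℝ) (y : X) : ℝ≥0∞ :=
  ∫⁻ z in Ω ∩ {z | dist z y ≤ τ * Metric.infDist y Ωᶜ},
    ‖u z - u y‖ₑ ^ p / edist z y ^ (n + s * p) ∂μ

/-- Integrability of `u` need not be assumed: if it fails, the right side is infinite, and otherwise
the Bochner average is not a default value. -/
lemma enorm_setAverage_sub_le {X : Type*} [MeasurableSpace X] {μ : Measure X} {E : Set X}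
    (h0 : μ E ≠ 0) (ht : μ E ≠ ∞) {u : X → ℝ} (hu : Measurable u) (a : ℝ) :
    ‖(⨍ x in E, u x ∂μ) - a‖ₑ ≤ (μ E)⁻¹ * ∫⁻ x in E, ‖u x - a‖ₑ ∂μ := by
  rcases eq_or_ne (∫⁻ x in E, ‖u x - a‖ₑ ∂μ) ∞ with h | h
  · rw [h, ENNReal.mul_top (ENNReal.inv_ne_zero.2 ht)]
    exact le_top
  have hint : IntegrableOn (fun x => u x - a) E μ :=
    ⟨(hu.sub_const a).aestronglyMeasurable, h.lt_top⟩
  have hconst : IntegrableOn (fun _ => a) E μ := integrableOn_const ht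
  have hu' : IntegrableOn u E μ := by
    simpa [Pi.add_def] using hint.add hconst
  have : (⨍ x in E, u x ∂μ) - a = ⨍ x in E, (u x - a) ∂μ := by
    rw [setAverage_eq, setAverage_eq, integral_sub hu' hconst, setIntegral_const, smul_sub,
      smul_smul, measureReal_def, inv_mul_cancel₀ (ENNReal.toReal_ne_zero.2 ⟨h0, ht⟩), one_smul]
  rw [this, setAverage_eq, enorm_smul]
  gcongr
  · rw [measureReal_def, enorm_inv (ENNReal.toReal_ne_zero.2 ⟨h0, ht⟩),
      Real.enorm_of_nonneg ENNReal.toReal_nonneg, ENNReal.ofReal_toReal ht]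
  · exact enorm_integral_le_lintegral_enorm _

/-- Hölder's inequality against a constant. -/
lemma setLIntegral_le_rpow_mul_measure_rpow {X : Type*} [MeasurableSpace X] {μ : Measure X}
    {E : Set X} {f : X → ℝ≥0∞} (hf : AEMeasurable f (μ.restrict E)) {p : ℝ} (hp : 1 < p) :
    ∫⁻ x in E, f x ∂μ ≤ (∫⁻ x in E, f x ^ p ∂μ) ^ (1 / p) * μ E ^ (1 - 1 / p) := by
  have hpq := Real.HolderConjugate.conjExponent hp
  have := ENNReal.lintegral_mul_le_Lp_mul_Lq (μ.restrict E) hpq hf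
    (g := fun _ => 1) aemeasurable_const
  simpa [hpq.one_sub_inv] using this

section

variable {X : Type*} [MetricSpace X] [MeasurableSpace X] {μ : Measure X}
  {Ω : Set X} {n s p τ : ℝ} {u : X → ℝ}

/-- On `E` the kernel denominator is at most `ρ ^ (n + s * p)`. Hölder's inequality then produces
the exponent `(n + s p) / p + n (1 - 1/p) = n + s`. -/
lemma lintegral_enorm_sub_le_localEnergy (hn : 0 < n) (hs : 0 < s) (hp : 1 < p) (hu : Measurable u)
    {y : X} {E : Set X} (hE : MeasurableSet E) (hEΩ : E ⊆ Ω) {ρ b : ℝ≥0∞}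
    (hρ0 : ρ ≠ 0) (hρt : ρ ≠ ∞)
    (hEρ : ∀ z ∈ E, edist z y ≤ ρ) (hEτ : ∀ z ∈ E, dist z y ≤ τ * Metric.infDist y Ωᶜ)
    (hμE : μ E ≤ b * ρ ^ n) :
    ∫⁻ z in E, ‖u z - u y‖ₑ ∂μ ≤
      b ^ (1 - 1 / p) * ρ ^ (n + s) * localEnergy μ Ω n s p τ u y ^ (1 / p) := by
  have hp0 : 0 < p := by linarith
  have hp1 : 0 ≤ 1 - 1 / p := by rw [sub_nonneg, div_le_one hp0]; exact hp.le
  have hexp : 0 < n + s * p := by positivity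
  have hm : Measurable fun z => ‖u z - u y‖ₑ := (hu.sub_const _).enorm
  have hle : ∫⁻ z in E, ‖u z - u y‖ₑ ^ p ∂μ ≤
      ρ ^ (n + s * p) * localEnergy μ Ω n s p τ u y := by
    calc ∫⁻ z in E, ‖u z - u y‖ₑ ^ p ∂μ
        ≤ ∫⁻ z in E, ρ ^ (n + s * p) * (‖u z - u y‖ₑ ^ p / edist z y ^ (n + s * p)) ∂μ := by
          refine setLIntegral_mono' hE fun z hz => ?_
          rcases eq_or_ne (edist z y) 0 with h0 | h0
          · rw [edist_eq_zero.1 h0]; simp [hp0]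
          · calc ‖u z - u y‖ₑ ^ p
                = edist z y ^ (n + s * p) * (‖u z - u y‖ₑ ^ p / edist z y ^ (n + s * p)) := by
                  rw [ENNReal.mul_div_cancel]
                  · simp [h0, edist_ne_top]
                  · exact ENNReal.rpow_ne_top_of_nonneg hexp.le (edist_ne_top _ _)
              _ ≤ _ := by gcongr; exact hEρ z hz
      _ = ρ ^ (n + s * p) * ∫⁻ z in E, ‖u z - u y‖ₑ ^ p / edist z y ^ (n + s * p) ∂μ :=
          lintegral_const_mul' _ _ (ENNReal.rpow_ne_top_of_nonneg hexp.le hρt)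
      _ ≤ _ := by
          unfold localEnergy
          gcongr
          exact fun z hz => ⟨hEΩ hz, hEτ z hz⟩
  calc ∫⁻ z in E, ‖u z - u y‖ₑ ∂μ
      ≤ (∫⁻ z in E, ‖u z - u y‖ₑ ^ p ∂μ) ^ (1 / p) * μ E ^ (1 - 1 / p) :=
        setLIntegral_le_rpow_mul_measure_rpow hm.aemeasurable hp
    _ ≤ (ρ ^ (n + s * p) * localEnergy μ Ω n s p τ u y) ^ (1 / p) *
          (b * ρ ^ n) ^ (1 - 1 / p) := by gcongr
    _ = b ^ (1 - 1 / p) * (ρ ^ ((n + s * p) * (1 / p)) * ρ ^ (n * (1 - 1 / p))) *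
          localEnergy μ Ω n s p τ u y ^ (1 / p) := by
        rw [ENNReal.mul_rpow_of_nonneg _ _ (by positivity), ENNReal.mul_rpow_of_nonneg _ _ hp1,
          ← ENNReal.rpow_mul, ← ENNReal.rpow_mul]
        ring
    _ = _ := by
        rw [← ENNReal.rpow_add _ _ hρ0 hρt]
        congr 3
        field_simp
        ring

/-- Comparison of the mean values over two large pieces of a small set. -/
lemma enorm_setAverage_sub_setAverage_le (hn : 0 < n) (hs : 0 < s) (hp : 1 < p) (hu : Measurable u)
    {B E E' : Set X} (hB : MeasurableSet B) (hBΩ : B ⊆ Ω) (hE' : MeasurableSet E')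
    (hEB : E ⊆ B) (hEB' : E' ⊆ B) {ρ b m : ℝ≥0∞} (hρ0 : ρ ≠ 0) (hρt : ρ ≠ ∞) (hb : b ≠ ∞)
    (hBρ : ∀ y ∈ B, ∀ z ∈ B, edist z y ≤ ρ)
    (hBτ : ∀ y ∈ B, ∀ z ∈ B, dist z y ≤ τ * Metric.infDist y Ωᶜ)
    (hμB : μ B ≤ b * ρ ^ n) (hm0 : m ≠ 0) (hmE : m ≤ μ E) (hmE' : m ≤ μ E') :
    ‖(⨍ x in E, u x ∂μ) - ⨍ x in E', u x ∂μ‖ₑ ≤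
      m⁻¹ * (m⁻¹ * (b ^ (1 - 1 / p) * ρ ^ (n + s)) *
        ∫⁻ y in B, localEnergy μ Ω n s p τ u y ^ (1 / p) ∂μ) := by
  have hp1 : 0 ≤ 1 - 1 / p := by rw [sub_nonneg, div_le_one (by linarith)]; exact hp.le
  have hBt : μ B ≠ ∞ := ne_top_of_le_ne_top
    (ENNReal.mul_ne_top hb (ENNReal.rpow_ne_top_of_nonneg hn.le hρt)) hμB
  have hpos : 0 < m := pos_iff_ne_zero.2 hm0
  refine (enorm_setAverage_sub_le (hpos.trans_le hmE).ne'
    (ne_top_of_le_ne_top hBt (measure_mono hEB)) hu _).trans ?_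
  gcongr
  -- Averaging twice: for each fixed `y` the inner mean over `E'` is bounded by the local energy at
  -- `y`.
  calc ∫⁻ y in E, ‖u y - ⨍ x in E', u x ∂μ‖ₑ ∂μ
      ≤ ∫⁻ y in B, ‖u y - ⨍ x in E', u x ∂μ‖ₑ ∂μ := lintegral_mono_set hEB
    _ ≤ ∫⁻ y in B, m⁻¹ * (b ^ (1 - 1 / p) * ρ ^ (n + s)) *
          localEnergy μ Ω n s p τ u y ^ (1 / p) ∂μ := by
        refine setLIntegral_mono' hB fun y hy => ?_
        rw [← enorm_neg, neg_sub, mul_assoc]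
        refine (enorm_setAverage_sub_le (hpos.trans_le hmE').ne'
          (ne_top_of_le_ne_top hBt (measure_mono hEB')) hu _).trans ?_
        gcongr
        exact lintegral_enorm_sub_le_localEnergy hn hs hp hu hE' (hEB'.trans hBΩ) hρ0 hρt
          (fun z hz => hBρ y hy z (hEB' hz)) (fun z hz => hBτ y hy z (hEB' hz))
          ((measure_mono hEB').trans hμB)
    _ = _ := by
        refine lintegral_const_mul' _ _ (ENNReal.mul_ne_top (ENNReal.inv_ne_top.2 hm0)
          (ENNReal.mul_ne_top (ENNReal.rpow_ne_top_of_nonneg hp1 hb)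
            (ENNReal.rpow_ne_top_of_nonneg (by positivity) hρt)))

/-- Tonelli's theorem needs a kernel measurable for the product σ-algebra, so the distance is
replaced by the measurable `D` that equals it over `Ω`. -/
lemma aemeasurable_localEnergy [BorelSpace X] (hΩ : MeasurableSet Ω) (hΩs : TopologicalSpace.IsSeparable Ω)
    (hfin : μ Ω ≠ ∞) (hτ : 0 ≤ τ) (hu : Measurable u) :
    AEMeasurable (localEnergy μ Ω n s p τ u) (μ.restrict Ω) := by
  obtain ⟨D, hDm, hD⟩ := hΩs.exists_measurable_eq_edist
  have : IsFiniteMeasure (μ.restrict Ω) := isFiniteMeasure_restrict.2 hfin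
  set S : Set (X × X) := {q | D q ≤ ENNReal.ofReal (τ * Metric.infDist q.2 Ωᶜ)} with hS
  have hδ : Measurable fun y : X => Metric.infDist y Ωᶜ :=
    (Metric.continuous_infDist_pt _).measurable
  have hSm : MeasurableSet S := measurableSet_le hDm
    ((hδ.comp measurable_snd).const_mul τ).ennreal_ofReal
  have hk : Measurable (S.indicator fun q : X × X => ‖u q.1 - u q.2‖ₑ ^ p / D q ^ (n + s * p)) :=
    ((((hu.comp measurable_fst).sub (hu.comp measurable_snd)).enorm.pow_const p).div
      (hDm.pow_const _)).indicator hSm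
  refine ⟨fun y => ∫⁻ z in Ω, S.indicator (fun q : X × X => ‖u q.1 - u q.2‖ₑ ^ p /
    D q ^ (n + s * p)) (z, y) ∂μ, hk.lintegral_prod_left', ?_⟩
  filter_upwards [ae_restrict_mem hΩ] with y hy
  have hSy : MeasurableSet {z | dist z y ≤ τ * Metric.infDist y Ωᶜ} :=
    measurableSet_le (continuous_id.dist (continuous_const (y := y))).measurable measurable_const
  rw [localEnergy, inter_comm, ← Measure.restrict_restrict hSy, ← lintegral_indicator hSy]
  refine setLIntegral_congr_fun hΩ fun z hz => ?_
  have hiff : (z, y) ∈ S ↔ dist z y ≤ τ * Metric.infDist y Ωᶜ := by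
    rw [hS, mem_ofPred_eq, hD z hz, edist_dist]
    exact ENNReal.ofReal_le_ofReal_iff (mul_nonneg hτ Metric.infDist_nonneg)
  by_cases h : (z, y) ∈ S
  · rw [indicator_of_mem h, indicator_of_mem (by exact hiff.1 h), hD z hz]
  · rw [indicator_of_notMem h, indicator_of_notMem (by exact fun h' => h (hiff.2 h'))]

end
-- Chains of balls along a John curve.
open Filter Topology

section

variable {X : Type*} [MetricSpace X] {Ω : Set X} {J T τ ε : ℝ} {x : X} {γ : ℝ → X}

/-- This fixes `ε = τ / (6 J)`: the doubled ball has radius at most `t / (3 J)`, so its points keep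
distance `2 t / (3 J)` from the complement, and `τ` times this is `4 ε t`, a bound for the ball's
diameter. All pairs in the ball are thus admissible. -/
lemma le_mul_infDist_of_mem_ball_curve (hτ : τ ∈ Ioo (0 : ℝ) 1) (hJ : 1 ≤ J) (hε : ε = τ / (6 * J))
    (hd : ∀ t ∈ Icc 0 T, t / J ≤ Metric.infDist (γ t) Ωᶜ) {t : ℝ} (ht : t ∈ Ioc 0 T) {w : X}
    (hw : w ∈ Metric.ball (γ t) (2 * (ε * t))) :
    4 * (ε * t) ≤ τ * Metric.infDist w Ωᶜ := by
  have hJ0 : 0 < J := by linarith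
  have h1 := hd t ⟨ht.1.le, ht.2⟩
  have h2 : Metric.infDist (γ t) Ωᶜ ≤ Metric.infDist w Ωᶜ + dist (γ t) w :=
    Metric.infDist_le_infDist_add_dist
  rw [Metric.mem_ball, dist_comm] at hw
  have h3 : ε * t = τ * (t / J) / 6 := by rw [hε]; field_simp
  have h4 : 0 < t / J := div_pos ht.1 hJ0
  have h5 : τ * (t / J) < t / J := by nlinarith [hτ.2]
  have h6 : t / J * (2 / 3) ≤ Metric.infDist w Ωᶜ := by linarith
  have := mul_le_mul_of_nonneg_left h6 hτ.1.le
  linarith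

/-- Passing from `t` to `(1 - ε) t` moves the centre by at most `ε t`, so the next small ball stays
in the current doubled ball. -/
lemma ball_curve_subset_ball (hε : 0 < ε) (hε1 : ε < 1)
    (hc : ∀ t ∈ Icc 0 T, ∀ t' ∈ Icc 0 T, dist (γ t) (γ t') ≤ |t - t'|) {t : ℝ} (ht : t ∈ Ioc 0 T) :
    Metric.ball (γ ((1 - ε) * t)) (ε * ((1 - ε) * t)) ⊆ Metric.ball (γ t) (2 * (ε * t)) := by
  have h0 : 0 < ε * t := mul_pos hε ht.1
  have h1 : dist (γ ((1 - ε) * t)) (γ t) ≤ ε * t := by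
    refine (hc _ ⟨mul_nonneg (by linarith) ht.1.le, by nlinarith [ht.2]⟩ _
      ⟨ht.1.le, ht.2⟩).trans ?_
    rw [show (1 - ε) * t - t = -(ε * t) by ring, abs_neg, abs_of_pos h0]
  refine Metric.ball_subset_ball' ?_
  nlinarith [mul_pos hε h0]

/-- Brings the chain within reach of the local energy at `x` and of the centred maximal function at
`x`. -/
lemma ball_curve_subset_closedBall (hε1 : ε ≤ 1 / 2) (h0 : γ 0 = x)
    (hc : ∀ t ∈ Icc 0 T, ∀ t' ∈ Icc 0 T, dist (γ t) (γ t') ≤ |t - t'|) {t : ℝ} (ht : t ∈ Ioc 0 T) :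
    Metric.ball (γ t) (2 * (ε * t)) ⊆ Metric.closedBall x (2 * t) := by
  have h1 : dist (γ t) x ≤ t := by
    rw [← h0]
    refine (hc _ ⟨ht.1.le, ht.2⟩ _ ⟨le_rfl, ht.1.le.trans ht.2⟩).trans ?_
    rw [sub_zero, abs_of_pos ht.1]
  refine (Metric.ball_subset_ball' (ε₂ := 2 * t) ?_).trans Metric.ball_subset_closedBall
  nlinarith [ht.1]

end

section

variable {X : Type*} [MetricSpace X] [MeasurableSpace X] [BorelSpace X] {μ : Measure X}
  {Ω : Set X} {n s p τ J T ε cl A : ℝ}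

/-- Telescoping along a chain of balls that shrinks to `x` inside the John curve of `x`. -/
theorem exists_enorm_sub_setAverage_le (hn : 0 < n) (hs : 0 < s) (hp : 1 < p)
    (hτ : τ ∈ Ioo (0 : ℝ) 1) (hJ : 1 ≤ J) (hε : ε = τ / (6 * J)) (hT : 0 < T) (hcl : 0 < cl)
    (hA : 0 < A)
    (hlow : ∀ y r, 0 < r → r < Metric.infDist y Ωᶜ →
      ENNReal.ofReal (cl * r ^ n) ≤ μ (Metric.ball y r))
    (hup : ∀ y r, 0 < r → μ.restrict Ω (Metric.closedBall y r) ≤ ENNReal.ofReal (A * r ^ n)) :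
    ∃ C : ℝ≥0∞, C ≠ ∞ ∧ ∀ u : X → ℝ, Measurable u → ∀ x ∈ Ω, 0 < Metric.infDist x Ωᶜ →
      ∀ γ : ℝ → X, γ 0 = x →
      (∀ t ∈ Icc 0 T, ∀ t' ∈ Icc 0 T, dist (γ t) (γ t') ≤ |t - t'|) →
      (∀ t ∈ Icc 0 T, t / J ≤ Metric.infDist (γ t) Ωᶜ) →
      localEnergy μ Ω n s p τ u x ≠ ∞ →
      ‖u x - ⨍ z in Metric.ball (γ T) (ε * T), u z ∂μ‖ₑ ≤
        C * ∑' k : ℕ, ENNReal.ofReal (T * (1 - ε) ^ k) ^ (s - n) *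
          ∫⁻ y in Metric.ball (γ (T * (1 - ε) ^ k)) (2 * (ε * (T * (1 - ε) ^ k))),
            localEnergy μ Ω n s p τ u y ^ (1 / p) ∂μ := by
  have hJ0 : 0 < J := by linarith
  have hε0 : 0 < ε := by rw [hε]; exact div_pos hτ.1 (by positivity)
  have hε6 : ε ≤ 1 / 6 := by
    rw [hε, div_le_div_iff₀ (by positivity) (by norm_num)]
    nlinarith [hτ.2]
  have hl0 : 0 < 1 - ε := by linarith
  have hl1 : 1 - ε < 1 := by linarith
  have hp1 : 0 ≤ 1 - 1 / p := by rw [sub_nonneg, div_le_one (by linarith)]; exact hp.le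
  have hns : 0 ≤ n + s := by positivity
  set c₁ : ℝ≥0∞ := ENNReal.ofReal (cl * (ε * (1 - ε)) ^ n) with hc₁
  set b : ℝ≥0∞ := ENNReal.ofReal A with hb
  have hbt : b ^ (1 - 1 / p) ≠ ∞ := ENNReal.rpow_ne_top_of_nonneg hp1 ENNReal.ofReal_ne_top
  have hc₁0 : c₁ ≠ 0 := by rw [hc₁, Ne, ENNReal.ofReal_eq_zero, not_le]; positivity
  have hc₁t : c₁ ≠ ∞ := ENNReal.ofReal_ne_top
  have hc₁i : c₁⁻¹ ≠ ∞ := ENNReal.inv_ne_top.2 hc₁0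
  have hsc : ∀ κ : ℝ, ENNReal.ofReal κ ^ (n + s) ≠ ∞ := fun κ =>
    ENNReal.rpow_ne_top_of_nonneg (by positivity) ENNReal.ofReal_ne_top
  refine ⟨c₁⁻¹ * c₁⁻¹ * (b ^ (1 - 1 / p) * ENNReal.ofReal (4 * ε) ^ (n + s)),
    ENNReal.mul_ne_top (ENNReal.mul_ne_top hc₁i hc₁i) (ENNReal.mul_ne_top hbt (hsc _)), ?_⟩
  intro u hu x hx hδx γ hγ0 hγ hd hfin
  set t : ℕ → ℝ := fun k => T * (1 - ε) ^ k with ht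
  have htpos : ∀ k, 0 < t k := fun k => by positivity
  have htmem : ∀ k, t k ∈ Ioc 0 T := fun k =>
    ⟨htpos k, mul_le_of_le_one_right hT.le (pow_le_one₀ hl0.le hl1.le)⟩
  have htsucc : ∀ k, t (k + 1) = (1 - ε) * t k := fun k => by simp only [ht, pow_succ]; ring
  have ht0 : ∀ k, ENNReal.ofReal (t k) ≠ 0 := fun k => by simpa using htpos k
  have htt : ∀ k, ENNReal.ofReal (t k) ≠ ∞ := fun k => ENNReal.ofReal_ne_top
  have hball : ∀ k, ∀ w ∈ Metric.ball (γ (t k)) (2 * (ε * t k)),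
      4 * (ε * t k) ≤ τ * Metric.infDist w Ωᶜ := fun k w hw =>
    le_mul_infDist_of_mem_ball_curve hτ hJ hε hd (htmem k) hw
  have hballΩ : ∀ k, Metric.ball (γ (t k)) (2 * (ε * t k)) ⊆ Ω := by
    intro k w hw
    by_contra hwΩ
    have h1 := hball k w hw
    rw [Metric.infDist_zero_of_mem (mem_compl hwΩ), mul_zero] at h1
    linarith [mul_pos hε0 (htpos k)]
  have hsmall : ∀ k, Metric.ball (γ (t k)) (ε * t k) ⊆ Metric.ball (γ (t k)) (2 * (ε * t k)) :=
    fun k => Metric.ball_subset_ball (by linarith [mul_pos hε0 (htpos k)])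
  have hlowk : ∀ k, ENNReal.ofReal (cl * (ε * t k) ^ n) ≤
      μ (Metric.ball (γ (t k)) (ε * t k)) := by
    intro k
    have hpos := mul_pos hε0 (htpos k)
    refine hlow _ _ hpos ?_
    have h1 := hball k (γ (t k)) (Metric.mem_ball_self (by linarith))
    nlinarith [hτ.1, hτ.2, Metric.infDist_nonneg (x := γ (t k)) (s := Ωᶜ)]
  -- The factor `1 - ε` in `c₁` makes this the lower mass bound of the smaller, next ball, so it
  -- serves both balls of a step.
  have hmk : ∀ k, c₁ * ENNReal.ofReal (t k) ^ n = ENNReal.ofReal (cl * (ε * t (k + 1)) ^ n) := by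
    intro k
    rw [hc₁, ENNReal.ofReal_rpow_of_pos (htpos k), ← ENNReal.ofReal_mul (by positivity), mul_assoc,
      ← Real.mul_rpow (by positivity) (htpos k).le, htsucc]
    ring_nf
  have hmle : ∀ k, c₁ * ENNReal.ofReal (t k) ^ n ≤ μ (Metric.ball (γ (t k)) (ε * t k)) := by
    intro k
    refine le_trans ?_ (hlowk k)
    rw [hmk, htsucc]
    have := htpos k
    gcongr
    nlinarith
  have hmle' : ∀ k, c₁ * ENNReal.ofReal (t k) ^ n ≤
      μ (Metric.ball (γ (t (k + 1))) (ε * t (k + 1))) := fun k => (hmk k).trans_le (hlowk (k + 1))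
  have hm0 : ∀ k, c₁ * ENNReal.ofReal (t k) ^ n ≠ 0 := fun k =>
    mul_ne_zero hc₁0 (by simp [ht0, htt])
  have hupper : ∀ k κ, 2 * ε ≤ κ → μ (Metric.ball (γ (t k)) (2 * (ε * t k))) ≤
      b * (ENNReal.ofReal (κ * t k)) ^ n := by
    intro k κ hκ
    have hk := htpos k
    rw [← Measure.restrict_eq_self μ (hballΩ k)]
    refine (measure_mono Metric.ball_subset_closedBall).trans
      ((hup _ _ (by positivity)).trans ?_)
    rw [hb, ENNReal.ofReal_rpow_of_pos (by nlinarith), ← ENNReal.ofReal_mul hA.le, ← mul_assoc]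
    gcongr
  have hinv : ∀ k, (c₁ * ENNReal.ofReal (t k) ^ n)⁻¹ = c₁⁻¹ * ENNReal.ofReal (t k) ^ (-n) := by
    intro k
    rw [ENNReal.mul_inv (.inl hc₁0) (.inl hc₁t), ENNReal.rpow_neg]
  have hlim : Tendsto t atTop (𝓝 0) := by
    simpa using (tendsto_pow_atTop_nhds_zero_of_lt_one hl0.le hl1).const_mul T
  -- No Lebesgue differentiation is needed: once `2 t_k ≤ τ δ(x)`, the ball pairs admissibly with
  -- `x` itself, and the error is at most a constant times `t_k^s` times the finite `localEnergy`
  -- root at `x`.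
  have hconv : Tendsto (fun k => ⨍ z in Metric.ball (γ (t k)) (ε * t k), u z ∂μ) atTop
      (𝓝 (u x)) := by
    rw [tendsto_iff_edist_tendsto_0]
    have hbound : Tendsto (fun k => c₁⁻¹ * (b ^ (1 - 1 / p) * ENNReal.ofReal 2 ^ (n + s) *
        localEnergy μ Ω n s p τ u x ^ (1 / p)) * ENNReal.ofReal (t k) ^ s) atTop (𝓝 0) := by
      have h1 : Tendsto (fun k => ENNReal.ofReal (t k) ^ s) atTop (𝓝 0) := by
        have h2 := ((ENNReal.continuous_rpow_const (y := s)).tendsto _).comp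
          (ENNReal.tendsto_ofReal hlim)
        simpa [hs, Function.comp_def] using h2
      have h3 := ENNReal.Tendsto.const_mul (a := c₁⁻¹ * (b ^ (1 - 1 / p) *
        ENNReal.ofReal 2 ^ (n + s) * localEnergy μ Ω n s p τ u x ^ (1 / p))) h1
        (.inr (ENNReal.mul_ne_top hc₁i (ENNReal.mul_ne_top (ENNReal.mul_ne_top hbt (hsc _))
          (ENNReal.rpow_ne_top_of_nonneg (by positivity) hfin))))
      simpa using h3
    refine tendsto_of_tendsto_of_tendsto_of_le_of_le' tendsto_const_nhds hbound
      (Eventually.of_forall fun _ => zero_le) ?_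
    have hev : ∀ᶠ k in atTop, t k < τ * Metric.infDist x Ωᶜ / 2 :=
      hlim.eventually_lt_const (by have := mul_pos hτ.1 hδx; linarith)
    filter_upwards [hev] with k hk
    have hk0 := htpos k
    have hcb : ∀ z ∈ Metric.ball (γ (t k)) (ε * t k), dist z x ≤ 2 * t k := fun z hz =>
      ball_curve_subset_closedBall (by linarith) hγ0 hγ (htmem k) (hsmall k hz)
    have hEt : μ (Metric.ball (γ (t k)) (ε * t k)) ≤ b * ENNReal.ofReal (2 * t k) ^ n :=
      (measure_mono (hsmall k)).trans (hupper k 2 (by linarith))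
    rw [edist_eq_enorm_sub]
    calc _ ≤ (μ (Metric.ball (γ (t k)) (ε * t k)))⁻¹ *
          ∫⁻ z in Metric.ball (γ (t k)) (ε * t k), ‖u z - u x‖ₑ ∂μ :=
          enorm_setAverage_sub_le ((pos_iff_ne_zero.2 (hm0 k)).trans_le (hmle k)).ne'
            (ne_top_of_le_ne_top (ENNReal.mul_ne_top ENNReal.ofReal_ne_top
              (ENNReal.rpow_ne_top_of_nonneg hn.le ENNReal.ofReal_ne_top)) hEt) hu _
      _ ≤ (c₁ * ENNReal.ofReal (t k) ^ n)⁻¹ * (b ^ (1 - 1 / p) *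
            ENNReal.ofReal (2 * t k) ^ (n + s) * localEnergy μ Ω n s p τ u x ^ (1 / p)) := by
          gcongr
          · exact hmle k
          · refine lintegral_enorm_sub_le_localEnergy hn hs hp hu Metric.isOpen_ball.measurableSet
              ((hsmall k).trans (hballΩ k)) (by simpa using hk0) ENNReal.ofReal_ne_top
              (fun z hz => ?_) (fun z hz => ?_) hEt
            · rw [edist_dist]
              exact ENNReal.ofReal_le_ofReal (hcb z hz)
            · linarith [hcb z hz]
      _ = c₁⁻¹ * (b ^ (1 - 1 / p) * ENNReal.ofReal 2 ^ (n + s) *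
            localEnergy μ Ω n s p τ u x ^ (1 / p)) *
            (ENNReal.ofReal (t k) ^ (-n) * ENNReal.ofReal (t k) ^ (n + s)) := by
          rw [hinv, ENNReal.ofReal_mul (p := 2) (by norm_num), ENNReal.mul_rpow_of_nonneg _ _ hns]
          ring
      _ = _ := by
          rw [← ENNReal.rpow_add _ _ (ht0 k) (htt k), neg_add_cancel_left]
  have hstep : ∀ k, edist (⨍ z in Metric.ball (γ (t k)) (ε * t k), u z ∂μ)
      (⨍ z in Metric.ball (γ (t k.succ)) (ε * t k.succ), u z ∂μ) ≤
      c₁⁻¹ * c₁⁻¹ * (b ^ (1 - 1 / p) * ENNReal.ofReal (4 * ε) ^ (n + s)) *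
        (ENNReal.ofReal (t k) ^ (s - n) *
          ∫⁻ y in Metric.ball (γ (t k)) (2 * (ε * t k)),
            localEnergy μ Ω n s p τ u y ^ (1 / p) ∂μ) := by
    intro k
    have hk0 := htpos k
    have hdist : ∀ y ∈ Metric.ball (γ (t k)) (2 * (ε * t k)),
        ∀ z ∈ Metric.ball (γ (t k)) (2 * (ε * t k)), dist z y ≤ 4 * (ε * t k) := by
      intro y hy z hz
      rw [Metric.mem_ball] at hy hz
      linarith [dist_triangle_right z y (γ (t k))]
    rw [edist_eq_enorm_sub]
    refine (enorm_setAverage_sub_setAverage_le (ρ := ENNReal.ofReal (4 * ε * t k)) (b := b)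
      (m := c₁ * ENNReal.ofReal (t k) ^ n) (τ := τ) hn hs hp hu
      Metric.isOpen_ball.measurableSet (hballΩ k) Metric.isOpen_ball.measurableSet (hsmall k)
      ?_ (by simp; positivity) ENNReal.ofReal_ne_top ENNReal.ofReal_ne_top ?_ ?_
      (hupper k _ (by linarith)) (hm0 k) (hmle k) (hmle' k)).trans (le_of_eq ?_)
    · rw [htsucc]
      exact ball_curve_subset_ball hε0 (by linarith) hγ (htmem k)
    · intro y hy z hz
      rw [edist_dist, mul_assoc]
      exact ENNReal.ofReal_le_ofReal (hdist y hy z hz)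
    · exact fun y hy z hz => (hdist y hy z hz).trans (hball k y hy)
    -- Two averages cost `t ^ (-n)` each, and the energy bound gains `t ^ (n + s)`.
    · have hexp : ENNReal.ofReal (t k) ^ (s - n) = ENNReal.ofReal (t k) ^ (-n) *
          (ENNReal.ofReal (t k) ^ (-n) * ENNReal.ofReal (t k) ^ (n + s)) := by
        rw [← ENNReal.rpow_add _ _ (ht0 k) (htt k), ← ENNReal.rpow_add _ _ (ht0 k) (htt k)]
        congr 1
        ring
      rw [hinv, ENNReal.ofReal_mul (p := 4 * ε) (by positivity), ENNReal.mul_rpow_of_nonneg _ _ hns,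
        hexp]
      ring
  have := edist_le_tsum_of_edist_le_of_tendsto₀ _ hstep hconv
  rw [ENNReal.tsum_mul_left] at this
  rw [← edist_eq_enorm_sub, edist_comm]
  simpa [ht] using this

end

/-! ### The weighted inequality through Hedberg's argument. -/

lemma maximalFn_congr_ae {X : Type*} [PseudoMetricSpace X] [MeasurableSpace X] {ν : Measure X}
    {n R : ℝ} {G G' : X → ℝ≥0∞} (h : G =ᵐ[ν] G') : maximalFn ν n R G = maximalFn ν n R G' := by
  ext x
  simp only [maximalFn]
  congr! 4 with r hr
  exact lintegral_congr_ae (ae_restrict_of_ae h)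

section

variable {X : Type*} [MetricSpace X] [MeasurableSpace X] [BorelSpace X] {μ : Measure X}
  {Ω : Set X} {n s γ p q τ J T ε cl A : ℝ}

/-- The weighted energy density, whose `L^p` norm is controlled by the truncated seminorm. -/
noncomputable def weightedEnergy (μ : Measure X) (Ω : Set X) (n s γ p q τ : ℝ) (w : X → ℝ≥0∞)
    (u : X → ℝ) (y : X) : ℝ≥0∞ :=
  ENNReal.ofReal (Metric.infDist y Ωᶜ) ^ γ * w y ^ (1 / q) * localEnergy μ Ω n s p τ u y ^ (1 / p)

/-- The weighted Sobolev–Poincaré inequality in terms of the weighted energy density. -/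
theorem exists_lintegral_weighted_le (hΩo : IsOpen Ω) (hΩne : Ωᶜ.Nonempty)
    (hΩs : TopologicalSpace.IsSeparable Ω) (hfin : μ Ω ≠ ∞) {x₀ : X} {c : X → ℝ → X}
    (hn : 0 < n) (hs : 0 < s) (hγ : 0 ≤ γ) (hγs : γ < s) (hp : 1 < p) (hpn : (s - γ) * p < n)
    (hq : q = n * p / (n - (s - γ) * p))
    (hτ : τ ∈ Ioo (0 : ℝ) 1) (hJ : 1 ≤ J) (hε : ε = τ / (6 * J)) (hT : 0 < T) (hcl : 0 < cl)
    (hA : 0 < A)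
    (hlow : ∀ y r, 0 < r → r < Metric.infDist y Ωᶜ →
      ENNReal.ofReal (cl * r ^ n) ≤ μ (Metric.ball y r))
    (hup : ∀ y r, 0 < r → μ.restrict Ω (Metric.closedBall y r) ≤ ENNReal.ofReal (A * r ^ n))
    (hc : ∀ x ∈ Ω, c x 0 = x ∧ c x T = x₀ ∧
      (∀ t ∈ Icc 0 T, ∀ t' ∈ Icc 0 T, dist (c x t) (c x t') ≤ |t - t'|) ∧
      ∀ t ∈ Icc 0 T, c x t ∈ Ω ∧ t / J ≤ Metric.infDist (c x t) Ωᶜ)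
    {Kw : ℝ≥0∞} (hKw : Kw ≠ ∞) :
    ∃ C : ℝ≥0∞, C ≠ ∞ ∧ ∀ u : X → ℝ, Measurable u → ∀ w : X → ℝ≥0∞,
      AEMeasurable w (μ.restrict Ω) → (∀ x ∈ Ω, w x ≠ 0 ∧ w x ≠ ∞) →
      (∀ x ∈ Ω, ∀ y ∈ Ω, dist y x ≤ 3 * J * Metric.infDist y Ωᶜ → w x ≤ Kw * w y) →
      ∫⁻ y in Ω, weightedEnergy μ Ω n s γ p q τ w u y ^ p ∂μ ≠ ∞ →
      ∫⁻ x in Ω, w x * ‖u x - ⨍ z in Metric.ball x₀ (ε * T), u z ∂μ‖ₑ ^ q ∂μ ≤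
        C * (∫⁻ y in Ω, weightedEnergy μ Ω n s γ p q τ w u y ^ p ∂μ) ^ (q / p) := by
  have hp0 : 0 < p := by linarith
  have hJ0 : 0 < J := by linarith
  have hε0 : 0 < ε := by rw [hε]; exact div_pos hτ.1 (by positivity)
  have hε6 : ε ≤ 1 / 6 := by
    rw [hε, div_le_div_iff₀ (by positivity) (by norm_num)]
    nlinarith [hτ.2]
  have hl0 : 0 < 1 - ε := by linarith
  have hl1 : 1 - ε < 1 := by linarith
  have hp1 : 0 ≤ 1 - 1 / p := by rw [sub_nonneg, div_le_one hp0]; exact hp.le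
  have hσ : 0 < s - γ := by linarith
  have hden : 0 < n - (s - γ) * p := by linarith
  have hq0 : 0 < q := by rw [hq]; positivity
  set a : ℝ := s - γ with ha
  set b : ℝ := n / p - a with hb
  have hb0 : 0 < b := by rw [hb, sub_pos, lt_div_iff₀ hp0]; exact hpn
  have hab : a + b = n / p := by rw [hb]; ring
  -- The choice of `q` is exactly what makes the `q`-th power of Hedberg's bound contain the maximal
  -- function to the power `p`.
  have hexp1 : b / (a + b) * q = p := by
    rw [hab, hb, hq]
    have : n - p * a ≠ 0 := by linarith
    field_simp
  have hexp2 : a / (a + b) * q = q - p := by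
    have : a / (a + b) + b / (a + b) = 1 := by
      rw [← add_div, div_self (by rw [hab]; positivity)]
    rw [← hexp1, show a / (a + b) = 1 - b / (a + b) by linarith]; ring
  have hqp : 0 ≤ q - p := by rw [← hexp2]; positivity
  obtain ⟨C₁, hC₁, hchain⟩ := exists_enorm_sub_setAverage_le (μ := μ) (Ω := Ω) hn hs hp hτ hJ hε hT
    hcl hA hlow hup
  obtain ⟨C₄, hC₄, hhed⟩ := ENNReal.exists_tsum_min_le (l := ENNReal.ofReal (1 - ε))
    (T := ENNReal.ofReal T) (by simpa using hl0)
    (by rw [← ENNReal.ofReal_one]; exact (ENNReal.ofReal_lt_ofReal_iff one_pos).2 hl1)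
    (by simpa using hT) ENNReal.ofReal_ne_top hσ hb0
  have : IsFiniteMeasure (μ.restrict Ω) := isFiniteMeasure_restrict.2 hfin
  -- Chain balls at parameter `t ≤ T` lie in `closedBall x (2 * t)`, so radii up to `2 T` suffice.
  obtain ⟨C₅, hC₅, hmax⟩ := exists_lintegral_maximalFn_rpow_le (R := 2 * T) hA.le hup hp
  set C₂ : ℝ≥0∞ := ENNReal.ofReal (3 / 2 * J) ^ γ * Kw ^ (1 / q) with hC₂
  have hC₂t : C₂ ≠ ∞ := ENNReal.mul_ne_top
    (ENNReal.rpow_ne_top_of_nonneg hγ ENNReal.ofReal_ne_top)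
    (ENNReal.rpow_ne_top_of_nonneg (by positivity) hKw)
  set C₃ : ℝ≥0∞ := ENNReal.ofReal (2 ^ n) + ENNReal.ofReal (A * 2 ^ n) ^ (1 - 1 / p) with hC₃
  have hC₃t : C₃ ≠ ∞ := ENNReal.add_ne_top.2 ⟨ENNReal.ofReal_ne_top,
    ENNReal.rpow_ne_top_of_nonneg hp1 ENNReal.ofReal_ne_top⟩
  set C₀ : ℝ≥0∞ := C₁ * (C₂ * (C₃ * C₄)) with hC₀
  have hC₀t : C₀ ≠ ∞ :=
    ENNReal.mul_ne_top hC₁ (ENNReal.mul_ne_top hC₂t (ENNReal.mul_ne_top hC₃t hC₄))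
  clear_value C₀
  refine ⟨C₀ ^ q * C₅, ENNReal.mul_ne_top (ENNReal.rpow_ne_top_of_nonneg hq0.le hC₀t) hC₅, ?_⟩
  intro u hu w hw hw0 hwK hI
  set G : X → ℝ≥0∞ := weightedEnergy μ Ω n s γ p q τ w u with hG
  set I : ℝ≥0∞ := ∫⁻ y in Ω, G y ^ p ∂μ with hIdef
  set M : X → ℝ≥0∞ := maximalFn (μ.restrict Ω) n (2 * T) G with hM
  have hem := aemeasurable_localEnergy (n := n) (s := s) (p := p) hΩo.measurableSet hΩs hfin
    hτ.1.le hu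
  have hGm : AEMeasurable G (μ.restrict Ω) :=
    (((Metric.continuous_infDist_pt _).measurable.ennreal_ofReal.pow_const γ).aemeasurable.mul
      (hw.pow_const _)).mul (hem.pow_const _)
  have hδ : ∀ x ∈ Ω, 0 < Metric.infDist x Ωᶜ := fun x hx =>
    (hΩo.isClosed_compl.notMem_iff_infDist_pos hΩne).1 (by simpa using hx)
  have hMI : ∫⁻ x in Ω, M x ^ p ∂μ ≤ C₅ * I := by
    have h1 := hmax _ hGm.measurable_mk
    rw [← maximalFn_congr_ae hGm.ae_eq_mk] at h1
    refine h1.trans_eq ?_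
    congr 1
    refine lintegral_congr_ae ?_
    filter_upwards [hGm.ae_eq_mk] with x hx
    rw [hx]
  -- Finite total energy and strictly positive weights give the finiteness required for telescoping.
  have hefin : ∀ᵐ x ∂μ.restrict Ω, localEnergy μ Ω n s p τ u x ≠ ∞ := by
    filter_upwards [ae_lt_top' (hGm.pow_const p) hI, ae_restrict_mem hΩo.measurableSet]
      with x hx hxΩ htop
    have h1 : ENNReal.ofReal (Metric.infDist x Ωᶜ) ^ γ * w x ^ (1 / q) ≠ 0 := by
      refine mul_ne_zero ?_ ?_
      · exact (ENNReal.rpow_pos (by simpa using hδ x hxΩ) ENNReal.ofReal_ne_top).ne'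
      · exact (ENNReal.rpow_pos (pos_iff_ne_zero.2 (hw0 x hxΩ).1) (hw0 x hxΩ).2).ne'
    have h2 : G x = ∞ := by
      rw [hG, weightedEnergy, htop, ENNReal.top_rpow_of_pos (by positivity), ENNReal.mul_top h1]
    rw [h2, ENNReal.top_rpow_of_pos hp0] at hx
    exact lt_irrefl _ hx
  have hpt : ∀ᵐ x ∂μ.restrict Ω, w x * ‖u x - ⨍ z in Metric.ball x₀ (ε * T), u z ∂μ‖ₑ ^ q ≤
      C₀ ^ q * (I ^ (1 / p)) ^ (q - p) * M x ^ p := by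
    filter_upwards [hefin, ae_restrict_mem hΩo.measurableSet] with x hxe hx
    obtain ⟨h0, hT0, hlip, hd⟩ := hc x hx
    have h1 := hchain u hu x hx (hδ x hx) (c x) h0 hlip (fun t ht => (hd t ht).2) hxe
    rw [hT0] at h1
    have hwx : w x ^ (1 / q) ≠ ∞ := ENNReal.rpow_ne_top_of_nonneg (by positivity) (hw0 x hx).2
    have hterm : ∀ k : ℕ, w x ^ (1 / q) * (ENNReal.ofReal (T * (1 - ε) ^ k) ^ (s - n) *
        ∫⁻ y in Metric.ball (c x (T * (1 - ε) ^ k)) (2 * (ε * (T * (1 - ε) ^ k))),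
          localEnergy μ Ω n s p τ u y ^ (1 / p) ∂μ) ≤
        C₂ * (C₃ * min ((ENNReal.ofReal T * ENNReal.ofReal (1 - ε) ^ k) ^ a * M x)
          ((ENNReal.ofReal T * ENNReal.ofReal (1 - ε) ^ k) ^ (-b) * I ^ (1 / p))) := by
      intro k
      rw [← ENNReal.ofReal_pow hl0.le, ← ENNReal.ofReal_mul hT.le]
      set t : ℝ := T * (1 - ε) ^ k with ht
      have ht0 : 0 < t := by positivity
      have htT : t ∈ Ioc 0 T :=
        ⟨ht0, mul_le_of_le_one_right hT.le (pow_le_one₀ hl0.le hl1.le)⟩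
      have ht0' : ENNReal.ofReal t ≠ 0 := by simpa using ht0
      have htt' : ENNReal.ofReal t ≠ ∞ := ENNReal.ofReal_ne_top
      clear_value t
      set B := Metric.ball (c x t) (2 * (ε * t)) with hB
      have hBm : MeasurableSet B := Metric.isOpen_ball.measurableSet
      have hBδ : ∀ y ∈ B, t ≤ 3 / 2 * J * Metric.infDist y Ωᶜ := by
        intro y hy
        have h2 := le_mul_infDist_of_mem_ball_curve hτ hJ hε (fun t ht => (hd t ht).2) htT hy
        have h3 : 4 * (ε * t) = τ * (t / (3 / 2 * J)) := by rw [hε]; field_simp; ring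
        rw [h3] at h2
        have h4 := le_of_mul_le_mul_left h2 hτ.1
        rwa [div_le_iff₀ (by positivity), mul_comm] at h4
      have hBΩ : B ⊆ Ω := by
        intro y hy
        by_contra hyΩ
        have h2 := hBδ y hy
        rw [Metric.infDist_zero_of_mem (mem_compl hyΩ), mul_zero] at h2
        linarith
      have hBx : B ⊆ Metric.closedBall x (2 * t) :=
        ball_curve_subset_closedBall (by linarith) h0 hlip htT
      have hpow2 : ENNReal.ofReal ((2 * t) ^ n) = ENNReal.ofReal (2 ^ n) * ENNReal.ofReal t ^ n := by
        rw [Real.mul_rpow (by norm_num) ht0.le, ENNReal.ofReal_mul (by positivity),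
          ENNReal.ofReal_rpow_of_pos ht0]
      -- The weights move from the base point `x` into the integral: `t ≤ (3/2) J δ(y)` with `0 ≤
      -- γ`, and the comparison of `w` applies since `dist y x ≤ 2 t ≤ 3 J δ(y)`.
      have hBG : ENNReal.ofReal t ^ γ * w x ^ (1 / q) *
          ∫⁻ y in B, localEnergy μ Ω n s p τ u y ^ (1 / p) ∂μ ≤ C₂ * ∫⁻ y in B, G y ∂μ := by
        rw [← lintegral_const_mul' _ _ (ENNReal.mul_ne_top
          (ENNReal.rpow_ne_top_of_nonneg hγ htt') hwx), ← lintegral_const_mul' _ _ hC₂t]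
        refine setLIntegral_mono' hBm fun y hy => ?_
        have hty := hBδ y hy
        have h3 : w x ≤ Kw * w y := by
          refine hwK x hx y (hBΩ hy) ?_
          have := hBx hy
          rw [Metric.mem_closedBall] at this
          linarith
        have h4 : ENNReal.ofReal t ≤
            ENNReal.ofReal (3 / 2 * J) * ENNReal.ofReal (Metric.infDist y Ωᶜ) := by
          rw [← ENNReal.ofReal_mul (by positivity)]
          exact ENNReal.ofReal_le_ofReal hty
        calc _ ≤ (ENNReal.ofReal (3 / 2 * J) * ENNReal.ofReal (Metric.infDist y Ωᶜ)) ^ γ *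
              (Kw * w y) ^ (1 / q) * localEnergy μ Ω n s p τ u y ^ (1 / p) := by gcongr
          _ = _ := by
              rw [ENNReal.mul_rpow_of_nonneg _ _ hγ, ENNReal.mul_rpow_of_nonneg _ _ (by positivity),
                hG, weightedEnergy, hC₂]
              ring
      have hres : μ.restrict B = (μ.restrict Ω).restrict B := by
        rw [Measure.restrict_restrict hBm, inter_eq_self_of_subset_left hBΩ]
      have hBM : ∫⁻ y in B, G y ∂μ ≤ ENNReal.ofReal (2 ^ n) * ENNReal.ofReal t ^ n * M x := by
        rw [hres, ← hpow2]
        exact (lintegral_mono_set hBx).trans (setLIntegral_closedBall_le_maximalFn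
          ⟨by positivity, by linarith [htT.2]⟩)
      -- Hölder's inequality on `B`; combined with `t ^ (a - n)` it gives the exponent `a - n / p =
      -- -b`.
      have hBI : ∫⁻ y in B, G y ∂μ ≤
          ENNReal.ofReal (A * 2 ^ n) ^ (1 - 1 / p) * ENNReal.ofReal t ^ (n * (1 - 1 / p)) *
            I ^ (1 / p) := by
        have hmB : μ B ≤ ENNReal.ofReal (A * 2 ^ n) * ENNReal.ofReal t ^ n := by
          rw [← Measure.restrict_eq_self μ hBΩ]
          refine (measure_mono hBx).trans ((hup x _ (by positivity)).trans_eq ?_)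
          rw [ENNReal.ofReal_mul hA.le, ENNReal.ofReal_mul hA.le, hpow2, mul_assoc]
        refine (setLIntegral_le_rpow_mul_measure_rpow
          (hGm.mono_measure (Measure.restrict_mono hBΩ le_rfl)) hp).trans ?_
        rw [mul_comm, ENNReal.rpow_mul, ← ENNReal.mul_rpow_of_nonneg _ _ hp1]
        gcongr
        exact lintegral_mono_set hBΩ
      have hsplit : ENNReal.ofReal t ^ (s - n) =
          ENNReal.ofReal t ^ (a - n) * ENNReal.ofReal t ^ γ := by
        rw [← ENNReal.rpow_add _ _ ht0' htt', ha]; congr 1; ring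
      calc _ = ENNReal.ofReal t ^ (a - n) * (ENNReal.ofReal t ^ γ * w x ^ (1 / q) *
            ∫⁻ y in B, localEnergy μ Ω n s p τ u y ^ (1 / p) ∂μ) := by rw [hsplit]; ring
        _ ≤ ENNReal.ofReal t ^ (a - n) * (C₂ * ∫⁻ y in B, G y ∂μ) := by gcongr
        _ = C₂ * (ENNReal.ofReal t ^ (a - n) * ∫⁻ y in B, G y ∂μ) := by ring
        _ ≤ _ := by
            refine mul_le_mul_right ?_ _
            rw [mul_min]
            refine le_min ?_ ?_
            · calc _ ≤ ENNReal.ofReal t ^ (a - n) *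
                    (ENNReal.ofReal (2 ^ n) * ENNReal.ofReal t ^ n * M x) := by gcongr
                _ = ENNReal.ofReal (2 ^ n) * (ENNReal.ofReal t ^ a * M x) := by
                    rw [show a = a - n + n by ring, ENNReal.rpow_add _ _ ht0' htt',
                      show a - n + n - n = a - n by ring]
                    ring
                _ ≤ _ := by gcongr; exact le_self_add
            · calc _ ≤ ENNReal.ofReal t ^ (a - n) * (ENNReal.ofReal (A * 2 ^ n) ^ (1 - 1 / p) *
                    ENNReal.ofReal t ^ (n * (1 - 1 / p)) * I ^ (1 / p)) := by gcongr
                _ = ENNReal.ofReal (A * 2 ^ n) ^ (1 - 1 / p) *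
                    (ENNReal.ofReal t ^ (-b) * I ^ (1 / p)) := by
                    rw [show -b = (a - n) + n * (1 - 1 / p) by rw [hb]; ring,
                      ENNReal.rpow_add _ _ ht0' htt']
                    ring
                _ ≤ _ := by gcongr; exact le_add_self
    have h2 : w x ^ (1 / q) * ‖u x - ⨍ z in Metric.ball x₀ (ε * T), u z ∂μ‖ₑ ≤
        C₀ * (M x ^ (b / (a + b)) * (I ^ (1 / p)) ^ (a / (a + b))) := by
      calc _ ≤ w x ^ (1 / q) * (C₁ * ∑' k : ℕ, ENNReal.ofReal (T * (1 - ε) ^ k) ^ (s - n) *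
            ∫⁻ y in Metric.ball (c x (T * (1 - ε) ^ k)) (2 * (ε * (T * (1 - ε) ^ k))),
              localEnergy μ Ω n s p τ u y ^ (1 / p) ∂μ) := by gcongr
        _ = C₁ * ∑' k : ℕ, w x ^ (1 / q) * (ENNReal.ofReal (T * (1 - ε) ^ k) ^ (s - n) *
            ∫⁻ y in Metric.ball (c x (T * (1 - ε) ^ k)) (2 * (ε * (T * (1 - ε) ^ k))),
              localEnergy μ Ω n s p τ u y ^ (1 / p) ∂μ) := by
            rw [ENNReal.tsum_mul_left]; ring
        _ ≤ C₁ * ∑' k : ℕ, C₂ * (C₃ *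
              min ((ENNReal.ofReal T * ENNReal.ofReal (1 - ε) ^ k) ^ a * M x)
              ((ENNReal.ofReal T * ENNReal.ofReal (1 - ε) ^ k) ^ (-b) * I ^ (1 / p))) := by
            exact mul_le_mul_right (ENNReal.tsum_le_tsum hterm) _
        _ ≤ C₁ * (C₂ * (C₃ * (C₄ * (M x ^ (b / (a + b)) * (I ^ (1 / p)) ^ (a / (a + b)))))) := by
            rw [ENNReal.tsum_mul_left, ENNReal.tsum_mul_left]
            gcongr
            exact hhed _ _
        _ = _ := by rw [hC₀]; ring
    calc w x * ‖u x - ⨍ z in Metric.ball x₀ (ε * T), u z ∂μ‖ₑ ^ q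
        = (w x ^ (1 / q) * ‖u x - ⨍ z in Metric.ball x₀ (ε * T), u z ∂μ‖ₑ) ^ q := by
          rw [ENNReal.mul_rpow_of_nonneg _ _ hq0.le, ← ENNReal.rpow_mul,
            one_div_mul_cancel hq0.ne', ENNReal.rpow_one]
      _ ≤ (C₀ * (M x ^ (b / (a + b)) * (I ^ (1 / p)) ^ (a / (a + b)))) ^ q := by gcongr
      _ = _ := by
          rw [ENNReal.mul_rpow_of_nonneg _ _ hq0.le, ENNReal.mul_rpow_of_nonneg _ _ hq0.le,
            ← ENNReal.rpow_mul (M x), ← ENNReal.rpow_mul (I ^ (1 / p)), hexp1, hexp2]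
          ring
  calc _ ≤ ∫⁻ x in Ω, C₀ ^ q * (I ^ (1 / p)) ^ (q - p) * M x ^ p ∂μ := lintegral_mono_ae hpt
    _ = C₀ ^ q * (I ^ (1 / p)) ^ (q - p) * ∫⁻ x in Ω, M x ^ p ∂μ :=
        lintegral_const_mul' _ _ (ENNReal.mul_ne_top (ENNReal.rpow_ne_top_of_nonneg hq0.le hC₀t)
          (ENNReal.rpow_ne_top_of_nonneg hqp (ENNReal.rpow_ne_top_of_nonneg (by positivity) hI)))
    _ ≤ C₀ ^ q * (I ^ (1 / p)) ^ (q - p) * (C₅ * I) := by gcongr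
    _ = C₀ ^ q * C₅ * (I ^ ((q - p) / p) * I ^ (1 : ℝ)) := by
        rw [← ENNReal.rpow_mul, ENNReal.rpow_one, show 1 / p * (q - p) = (q - p) / p by ring]
        ring
    _ = _ := by
        rw [← ENNReal.rpow_add_of_nonneg _ _ (by positivity) zero_le_one]
        congr 2
        field_simp
        ring

end

/-! ### Doubling weights and comparison with the truncated seminorm. -/

lemma le_pow_mul_of_doubling {φ : ℝ → ℝ} {K : ℝ} (hpos : ∀ t, 0 < t → 0 < φ t)
    (hmono : MonotoneOn φ (Ioi 0)) (hdbl : ∀ t, 0 < t → φ (2 * t) ≤ K * φ t) (m : ℕ) {a b : ℝ}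
    (ha : 0 < a) (hb : 0 < b) (h : a ≤ 2 ^ m * b) : φ a ≤ max K 1 ^ m * φ b := by
  have key : ∀ k : ℕ, φ (2 ^ k * b) ≤ max K 1 ^ k * φ b := by
    intro k
    induction k with
    | zero => simp
    | succ k ih =>
      have h1 : 0 < 2 ^ k * b := by positivity
      calc φ (2 ^ (k + 1) * b) = φ (2 * (2 ^ k * b)) := by ring_nf
        _ ≤ K * φ (2 ^ k * b) := hdbl _ h1
        _ ≤ max K 1 * φ (2 ^ k * b) :=
            mul_le_mul_of_nonneg_right (le_max_left _ _) (hpos _ h1).le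
        _ ≤ max K 1 * (max K 1 ^ k * φ b) := by gcongr
        _ = _ := by ring
  exact (hmono ha (by simpa using (by positivity : 0 < 2 ^ m * b)) h).trans (key m)

section

variable {X : Type*} [MetricSpace X] {Ω F : Set X}

/-- The John condition measures distance to the complement, the seminorm distance to the boundary.
In a general metric space the latter can be larger; this one-sided comparison is enough. -/
lemma infDist_compl_le_infDist_of_subset_frontier (hΩo : IsOpen Ω) (hF : F ⊆ frontier Ω)
    (hFne : F.Nonempty) (x : X) : Metric.infDist x Ωᶜ ≤ Metric.infDist x F :=
  Metric.infDist_le_infDist_of_subset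
    (hF.trans (by rw [hΩo.frontier_eq]; exact fun _ hx => hx.2)) hFne

variable [MeasurableSpace X] {μ : Measure X} {φ : ℝ → ℝ}

/-- `φ` is controlled only on the positive half-line. Set to zero elsewhere it becomes monotone,
hence Borel, and nothing changes on `Ω`. -/
lemma aemeasurable_comp_infDist [BorelSpace X] (hΩo : IsOpen Ω) (hpos : ∀ t, 0 < t → 0 < φ t)
    (hmono : MonotoneOn φ (Ioi 0)) (hF : ∀ x ∈ Ω, 0 < Metric.infDist x F) :
    AEMeasurable (fun x => ENNReal.ofReal (φ (Metric.infDist x F))) (μ.restrict Ω) := by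
  have hm : Monotone ((Ioi (0 : ℝ)).indicator φ) := by
    intro a b hab
    by_cases ha : 0 < a
    · rw [indicator_of_mem (by exact ha), indicator_of_mem (by exact ha.trans_le hab)]
      exact hmono ha (ha.trans_le hab) hab
    · rw [indicator_of_notMem (by exact ha)]
      exact indicator_nonneg (fun t ht => (hpos t ht).le) b
  refine ⟨fun x => ENNReal.ofReal ((Ioi (0 : ℝ)).indicator φ (Metric.infDist x F)),
    (hm.measurable.comp (Metric.continuous_infDist_pt F).measurable).ennreal_ofReal, ?_⟩
  filter_upwards [ae_restrict_mem hΩo.measurableSet] with x hx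
  rw [indicator_of_mem (by exact hF x hx)]

/-- The weighted energy is controlled by the truncated seminorm. -/
lemma exists_lintegral_weightedEnergy_le [BorelSpace X] {n s γ p q τ K cu : ℝ} (hΩo : IsOpen Ω)
    (hΩne : Ωᶜ.Nonempty) (hγ : 0 ≤ γ) (hp : 1 < p) (hq : 0 < q)
    (hτ : τ ∈ Ioo (0 : ℝ) 1) (hcu : 0 < cu)
    (hup : ∀ z r y, 0 < r → r < Metric.infDist y Ωᶜ →
      μ (Metric.ball z r) ≤ ENNReal.ofReal (cu * r ^ n)) :
    ∃ C : ℝ≥0∞, C ≠ ∞ ∧ ∀ (F : Set X) (φ : ℝ → ℝ), F.Nonempty → F ⊆ frontier Ω →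
      (∀ t, 0 < t → 0 < φ t) → MonotoneOn φ (Ioi 0) → (∀ t, 0 < t → φ (2 * t) ≤ K * φ t) →
      ∀ u : X → ℝ, ∫⁻ y in Ω, weightedEnergy μ Ω n s γ p q τ
          (fun x => ENNReal.ofReal (φ (Metric.infDist x F))) u y ^ p ∂μ ≤
        C * truncatedSeminorm μ Ω s p τ (minWeight Ω F (fun t => φ t ^ (p / q)) (γ * p)) u ^ p := by
  have hp0 : 0 < p := by linarith
  have hτ1 : 0 < 1 - τ := by linarith [hτ.2]
  have hτi : 1 ≤ (1 - τ)⁻¹ := (one_le_inv₀ hτ1).2 (by linarith [hτ.1])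
  obtain ⟨m, hm⟩ := pow_unbounded_of_one_lt (1 - τ)⁻¹ (one_lt_two (α := ℝ))
  have hγp : 0 ≤ γ * p := by positivity
  have hpq : 0 ≤ p / q := by positivity
  -- For admissible pairs the distances from `y` are at most `(1 - τ)⁻¹ < 2 ^ m` times those from
  -- `z`; the two factors are the resulting losses in the distance power and in `φ`.
  set C₀ : ℝ := ((1 - τ)⁻¹) ^ (γ * p) * (max K 1 ^ m) ^ (p / q) with hC₀
  have hC₀0 : 0 ≤ C₀ := by positivity
  set cu' : ℝ≥0∞ := ENNReal.ofReal cu with hcu'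
  have hcu0 : cu' ≠ 0 := by simpa [hcu'] using hcu
  refine ⟨ENNReal.ofReal C₀ * cu', ENNReal.mul_ne_top ENNReal.ofReal_ne_top ENNReal.ofReal_ne_top,
    fun F φ hFne hF hpos hmono hdbl u => ?_⟩
  have hδ : ∀ x ∈ Ω, 0 < Metric.infDist x Ωᶜ := fun x hx =>
    (hΩo.isClosed_compl.notMem_iff_infDist_pos hΩne).1 (by simpa using hx)
  have hδF := infDist_compl_le_infDist_of_subset_frontier hΩo hF hFne
  have hδfr := infDist_compl_le_infDist_of_subset_frontier hΩo subset_rfl (hFne.mono hF)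
  have hweight : ∀ y ∈ Ω, ∀ x ∈ Ω, Metric.infDist y Ωᶜ ≤ (1 - τ)⁻¹ * Metric.infDist x Ωᶜ →
      Metric.infDist y F ≤ (1 - τ)⁻¹ * Metric.infDist x F →
      Metric.infDist y Ωᶜ ^ (γ * p) * φ (Metric.infDist y F) ^ (p / q) ≤
        C₀ * (Metric.infDist x (frontier Ω) ^ (γ * p) * φ (Metric.infDist x F) ^ (p / q)) := by
    intro y hy x hx h1 h2
    have hyF := (hδ y hy).trans_le (hδF y)
    have hxF := (hδ x hx).trans_le (hδF x)
    have h3 : φ (Metric.infDist y F) ≤ max K 1 ^ m * φ (Metric.infDist x F) :=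
      le_pow_mul_of_doubling hpos hmono hdbl m hyF hxF
        (h2.trans (mul_le_mul_of_nonneg_right hm.le hxF.le))
    have h4 : Metric.infDist y Ωᶜ ≤ (1 - τ)⁻¹ * Metric.infDist x (frontier Ω) :=
      h1.trans (by gcongr; exact hδfr x)
    calc _ ≤ ((1 - τ)⁻¹ * Metric.infDist x (frontier Ω)) ^ (γ * p) *
          (max K 1 ^ m * φ (Metric.infDist x F)) ^ (p / q) := by
          have := (hpos _ hyF).le
          have := Metric.infDist_nonneg (x := y) (s := Ωᶜ)
          have := Metric.infDist_nonneg (x := x) (s := frontier Ω)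
          gcongr
      _ = _ := by
          rw [Real.mul_rpow (by positivity) Metric.infDist_nonneg,
            Real.mul_rpow (by positivity) (hpos _ hxF).le, hC₀]
          ring
  set v := minWeight Ω F (fun t => φ t ^ (p / q)) (γ * p) with hv
  have hmain : ∀ y ∈ Ω, ∀ z ∈ Ω, dist z y ≤ τ * Metric.infDist y Ωᶜ →
      Metric.infDist y Ωᶜ ^ (γ * p) * φ (Metric.infDist y F) ^ (p / q) ≤ C₀ * v z y := by
    intro y hy z hz hzy
    rw [hv, minWeight, mul_min_of_nonneg _ _ hC₀0]
    have hle : ∀ S : Set X, Metric.infDist y Ωᶜ ≤ Metric.infDist y S →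
        Metric.infDist y S ≤ (1 - τ)⁻¹ * Metric.infDist z S := by
      intro S hS
      have h1 : Metric.infDist y S ≤ Metric.infDist z S + dist y z :=
        Metric.infDist_le_infDist_add_dist
      rw [dist_comm] at h1
      rw [inv_mul_eq_div, le_div_iff₀ hτ1]
      have := mul_le_mul_of_nonneg_left hS hτ.1.le
      linarith
    -- The weight at `y` is controlled by that at `z` and by that at `y`, hence by their minimum.
    refine le_min (hweight y hy z hz (hle _ le_rfl) (hle _ (hδF y))) (hweight y hy y hy ?_ ?_)
    · exact le_mul_of_one_le_left Metric.infDist_nonneg hτi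
    · exact le_mul_of_one_le_left Metric.infDist_nonneg hτi
  have hker : ∀ y ∈ Ω, ∀ z ∈ Ω, dist z y ≤ τ * Metric.infDist y Ωᶜ →
      ENNReal.ofReal (Metric.infDist y Ωᶜ ^ (γ * p) * φ (Metric.infDist y F) ^ (p / q)) *
        (‖u z - u y‖ₑ ^ p / edist z y ^ (n + s * p)) ≤
      ENNReal.ofReal C₀ * cu' * (ENNReal.ofReal (|u z - u y| ^ p * v z y) /
        (μ (Metric.ball z (dist z y)) * ENNReal.ofReal (dist z y ^ (s * p)))) := by
    intro y hy z hz hzy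
    rcases eq_or_ne z y with rfl | hne
    · simp [hp0]
    have hd : 0 < dist z y := dist_pos.2 hne
    have hδy := hδ y hy
    have hball := hup z _ y hd (hzy.trans_lt (by nlinarith [hτ.2]))
    have hdp : ENNReal.ofReal (cu * dist z y ^ n) * ENNReal.ofReal (dist z y ^ (s * p)) =
        cu' * edist z y ^ (n + s * p) := by
      rw [edist_dist, ENNReal.ofReal_rpow_of_pos hd, ENNReal.ofReal_mul hcu.le, mul_assoc,
        ← ENNReal.ofReal_mul (by positivity), ← Real.rpow_add hd]
    have hnum : ENNReal.ofReal (|u z - u y| ^ p * v z y) =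
        ‖u z - u y‖ₑ ^ p * ENNReal.ofReal (v z y) := by
      rw [ENNReal.ofReal_mul (by positivity), ← ENNReal.ofReal_rpow_of_nonneg (abs_nonneg _) hp0.le,
        Real.enorm_eq_ofReal_abs]
    calc _ ≤ ENNReal.ofReal (C₀ * v z y) * (‖u z - u y‖ₑ ^ p / edist z y ^ (n + s * p)) := by
          exact mul_le_mul_left (ENNReal.ofReal_le_ofReal (hmain y hy z hz hzy)) _
      _ = ENNReal.ofReal C₀ * (cu' * cu'⁻¹) *
            (‖u z - u y‖ₑ ^ p * ENNReal.ofReal (v z y) * (edist z y ^ (n + s * p))⁻¹) := by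
          rw [ENNReal.mul_inv_cancel hcu0 ENNReal.ofReal_ne_top, ENNReal.ofReal_mul hC₀0,
            div_eq_mul_inv]
          ring
      _ = ENNReal.ofReal C₀ * cu' * (ENNReal.ofReal (|u z - u y| ^ p * v z y) /
            (ENNReal.ofReal (cu * dist z y ^ n) * ENNReal.ofReal (dist z y ^ (s * p)))) := by
          rw [hdp, hnum, div_eq_mul_inv,
            ENNReal.mul_inv (.inl hcu0) (.inl ENNReal.ofReal_ne_top)]
          ring
      _ ≤ _ := by gcongr
  rw [truncatedSeminorm, ← ENNReal.rpow_mul, one_div_mul_cancel hp0.ne', ENNReal.rpow_one,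
    ← lintegral_const_mul' _ _ (ENNReal.mul_ne_top ENNReal.ofReal_ne_top ENNReal.ofReal_ne_top)]
  refine setLIntegral_mono' hΩo.measurableSet fun y hy => ?_
  have hyF := (hδ y hy).trans_le (hδF y)
  have hSm : MeasurableSet (Ω ∩ {z | dist z y ≤ τ * Metric.infDist y Ωᶜ}) :=
    hΩo.measurableSet.inter (measurableSet_le
      (continuous_id.dist (continuous_const (y := y))).measurable measurable_const)
  have hGp : weightedEnergy μ Ω n s γ p q τ
      (fun x => ENNReal.ofReal (φ (Metric.infDist x F))) u y ^ p =
      ENNReal.ofReal (Metric.infDist y Ωᶜ ^ (γ * p) * φ (Metric.infDist y F) ^ (p / q)) *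
        localEnergy μ Ω n s p τ u y := by
    rw [weightedEnergy, ENNReal.mul_rpow_of_nonneg _ _ hp0.le, ENNReal.mul_rpow_of_nonneg _ _ hp0.le,
      ← ENNReal.rpow_mul, ← ENNReal.rpow_mul, ← ENNReal.rpow_mul, one_div_mul_cancel hp0.ne',
      ENNReal.rpow_one, ENNReal.ofReal_mul (Real.rpow_nonneg Metric.infDist_nonneg _),
      ← ENNReal.ofReal_rpow_of_nonneg Metric.infDist_nonneg hγp,
      ← ENNReal.ofReal_rpow_of_nonneg (hpos _ hyF).le hpq, one_div_mul_eq_div]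
  rw [hGp, localEnergy, ← lintegral_const_mul' _ _ ENNReal.ofReal_ne_top,
    ← lintegral_const_mul' _ _ (ENNReal.mul_ne_top ENNReal.ofReal_ne_top ENNReal.ofReal_ne_top)]
  calc _ ≤ ∫⁻ z in Ω ∩ {z | dist z y ≤ τ * Metric.infDist y Ωᶜ},
        ENNReal.ofReal C₀ * cu' * (ENNReal.ofReal (|u z - u y| ^ p * v z y) /
          (μ (Metric.ball z (dist z y)) * ENNReal.ofReal (dist z y ^ (s * p)))) ∂μ :=
        setLIntegral_mono' hSm fun z hz => hker y hy z hz.1 hz.2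
    _ ≤ _ := by
        -- The region truncated by distance to the complement lies in the one truncated by distance
        -- to the boundary.
        refine lintegral_mono_set fun z hz => ⟨hz.1, ?_⟩
        exact (show dist z y ≤ _ from hz.2).trans (mul_le_mul_of_nonneg_left (hδfr y) hτ.1.le)

lemma truncatedSeminorm_congr_ae {s p τ : ℝ} {v : X → X → ℝ} {u u' : X → ℝ}
    (h : u =ᵐ[μ.restrict Ω] u') :
    truncatedSeminorm μ Ω s p τ v u = truncatedSeminorm μ Ω s p τ v u' := by
  unfold truncatedSeminorm
  congr 1
  refine lintegral_congr_ae ?_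
  filter_upwards [h] with y hy
  refine lintegral_congr_ae ?_
  filter_upwards [ae_restrict_of_ae_restrict_of_subset inter_subset_left h] with z hz
  rw [hy, hz]

lemma eLpNorm_weightedMeasure_eq {q : ℝ} (hq : 0 < q) {f : X → ℝ}
    (hf : Measurable f)
    (hw : AEMeasurable (fun x => ENNReal.ofReal (φ (Metric.infDist x F))) (μ.restrict Ω)) :
    eLpNorm f (ENNReal.ofReal q) (weightedMeasure μ Ω F φ) =
      (∫⁻ x in Ω, ENNReal.ofReal (φ (Metric.infDist x F)) * ‖f x‖ₑ ^ q ∂μ) ^ (1 / q) := by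
  rw [eLpNorm_eq_lintegral_rpow_enorm_toReal (by simpa using hq) ENNReal.ofReal_ne_top,
    ENNReal.toReal_ofReal hq.le, weightedMeasure,
    lintegral_withDensity_eq_lintegral_mul₀ hw (hf.enorm.pow_const q).aemeasurable]
  rfl

end

/-! ### The main theorem. -/

theorem theorem3p3 {X : Type*} [MetricSpace X] [MeasurableSpace X] [BorelSpace X]
    (μ : Measure X) (n s τ γ p pstar K : ℝ) (Ω : Set X)
    (hμ : IsAhlforsRegular μ n)
    (hs : s ∈ Ioo (0 : ℝ) 1) (hτ : τ ∈ Ioo (0 : ℝ) 1)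
    (hγ : 0 ≤ γ) (hγs : γ < s) (hsn : s ≤ n)
    (hp : 1 < p) (hpn : (s - γ) * p < n)
    (hpstar : pstar = n * p / (n - (s - γ) * p))
    (hΩ : IsJohnDomain Ω) (hΩb : Bornology.IsBounded Ω) :
    ∃ C : ℝ≥0, ∀ (F : Set X) (φ : ℝ → ℝ),
      IsCompact F → F.Nonempty → F ⊆ frontier Ω →
      (∀ t, 0 < t → 0 < φ t) → MonotoneOn φ (Ioi 0) →
      (∀ t, 0 < t → φ (2 * t) ≤ K * φ t) →
      ∀ u : X → ℝ, AEStronglyMeasurable u (μ.restrict Ω) →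
        (⨅ a : ℝ, eLpNorm (fun x => u x - a) (ENNReal.ofReal pstar) (weightedMeasure μ Ω F φ)) ≤
          C * truncatedSeminorm μ Ω s p τ
            (minWeight Ω F (fun t => φ t ^ (p / pstar)) (γ * p)) u := by
  have hΩo : IsOpen Ω := hΩ.1
  rcases (frontier Ω).eq_empty_or_nonempty with hfr | hfr
  · refine ⟨0, fun F φ _ hFne hF => ?_⟩
    rw [hfr, subset_empty_iff] at hF
    exact absurd hF hFne.ne_empty
  have hΩne : Ωᶜ.Nonempty := hfr.mono (by rw [hΩo.frontier_eq]; exact fun _ hx => hx.2)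
  have hδ : ∀ x ∈ Ω, 0 < Metric.infDist x Ωᶜ := fun x hx =>
    (hΩo.isClosed_compl.notMem_iff_infDist_pos hΩne).1 (by simpa using hx)
  have hn : 0 < n := hs.1.trans_le hsn
  have hp0 : 0 < p := by linarith
  have hden : 0 < n - (s - γ) * p := by linarith
  have hq0 : 0 < pstar := by rw [hpstar]; positivity
  obtain ⟨x₀, J, T, c, hJ, hT, hc⟩ := hΩ.exists_curves hΩne
  obtain ⟨y₀, hy₀⟩ := hΩ.2.1.nonempty
  have hdiam : Metric.ediam (univ : Set X) ≠ 0 := by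
    have := ofReal_lt_ediam_of_lt_infDist hΩne le_rfl (hδ y₀ hy₀)
    exact ((zero_le).trans_lt this).ne'
  obtain ⟨hΩs, hfin, A, hA, hup⟩ := hμ.exists_measure_inter_closedBall_le hn hdiam hT
    (fun x hx => (hc x hx).1) (fun x hx => (hc x hx).2.1) (fun x hx => (hc x hx).2.2.1)
  obtain ⟨cl, cu, hcl, hcu, hreg⟩ := hμ
  have hreg' : ∀ z r y, 0 < r → r < Metric.infDist y Ωᶜ →
      ENNReal.ofReal (cl * r ^ n) ≤ μ (Metric.ball z r) ∧
        μ (Metric.ball z r) ≤ ENNReal.ofReal (cu * r ^ n) := fun z r y hr h =>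
    hreg z r hr (ofReal_lt_ediam_of_lt_infDist hΩne hr.le h)
  -- If `dist y x ≤ 3 J δ(y)`, then `d(x, F) ≤ (1 + 3 J) d(y, F)`, so `m` doublings of `φ` suffice.
  obtain ⟨m, hm⟩ := pow_unbounded_of_one_lt (1 + 3 * J) (one_lt_two (α := ℝ))
  obtain ⟨C₁, hC₁, hmain⟩ := exists_lintegral_weighted_le hΩo hΩne hΩs hfin.ne hn hs.1 hγ hγs hp hpn
    hpstar hτ hJ rfl hT hcl hA (fun y r hr h => (hreg' y r y hr h).1) hup hc
    (Kw := ENNReal.ofReal (max K 1 ^ m)) ENNReal.ofReal_ne_top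
  obtain ⟨C₂, hC₂, henergy⟩ := exists_lintegral_weightedEnergy_le (K := K) (n := n) (s := s) hΩo hΩne hγ hp hq0
    hτ hcu (fun z r y hr h => (hreg' z r y hr h).2)
  have hC : C₁ ^ (1 / pstar) * C₂ ^ (1 / p) ≠ ∞ := ENNReal.mul_ne_top
    (ENNReal.rpow_ne_top_of_nonneg (by positivity) hC₁)
    (ENNReal.rpow_ne_top_of_nonneg (by positivity) hC₂)
  -- Adding `1` keeps the constant nonzero, so that its product with an infinite seminorm is `∞`
  -- rather than `0 * ∞ = 0`.
  refine ⟨(C₁ ^ (1 / pstar) * C₂ ^ (1 / p)).toNNReal + 1, ?_⟩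
  intro F φ _ hFne hF hpos hmono hdbl u hu
  set S := truncatedSeminorm μ Ω s p τ (minWeight Ω F (fun t => φ t ^ (p / pstar)) (γ * p)) u with hS
  rcases eq_or_ne S ∞ with hStop | hSfin
  · rw [hStop, ENNReal.mul_top (by simp)]
    exact le_top
  have hδF := infDist_compl_le_infDist_of_subset_frontier hΩo hF hFne
  have hFpos : ∀ x ∈ Ω, 0 < Metric.infDist x F := fun x hx => (hδ x hx).trans_le (hδF x)
  set w : X → ℝ≥0∞ := fun x => ENNReal.ofReal (φ (Metric.infDist x F)) with hw
  have hwm : AEMeasurable w (μ.restrict Ω) := aemeasurable_comp_infDist hΩo hpos hmono hFpos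
  have hu' : Measurable (hu.mk u) := hu.stronglyMeasurable_mk.measurable
  have hG := henergy F φ hFne hF hpos hmono hdbl (hu.mk u)
  rw [← truncatedSeminorm_congr_ae hu.ae_eq_mk, ← hS] at hG
  have hfinal := hmain (hu.mk u) hu' w hwm
    (fun x hx => ⟨by simpa [hw] using hpos _ (hFpos x hx), ENNReal.ofReal_ne_top⟩) ?_
    (ne_top_of_le_ne_top (ENNReal.mul_ne_top hC₂ (ENNReal.rpow_ne_top_of_nonneg hp0.le hSfin)) hG)
  · set a : ℝ := ⨍ z in Metric.ball x₀ (τ / (6 * J) * T), hu.mk u z ∂μ with ha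
    have hae : (fun x => u x - a) =ᵐ[weightedMeasure μ Ω F φ] fun x => hu.mk u x - a := by
      filter_upwards [(withDensity_absolutelyContinuous _ _).ae_eq hu.ae_eq_mk] with x hx
      rw [hx]
    calc _ ≤ eLpNorm (fun x => u x - a) (ENNReal.ofReal pstar) (weightedMeasure μ Ω F φ) :=
          iInf_le _ a
      _ = (∫⁻ x in Ω, w x * ‖hu.mk u x - a‖ₑ ^ pstar ∂μ) ^ (1 / pstar) := by
          rw [eLpNorm_congr_ae hae, eLpNorm_weightedMeasure_eq hq0 (hu'.sub_const a) hwm]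
      _ ≤ (C₁ * (C₂ * S ^ p) ^ (pstar / p)) ^ (1 / pstar) := by
          gcongr
          refine hfinal.trans ?_
          gcongr
      _ = C₁ ^ (1 / pstar) * C₂ ^ (1 / p) * S := by
          rw [ENNReal.mul_rpow_of_nonneg _ _ (by positivity), ← ENNReal.rpow_mul,
            show pstar / p * (1 / pstar) = 1 / p by field_simp,
            ENNReal.mul_rpow_of_nonneg _ _ (by positivity), ← ENNReal.rpow_mul,
            mul_one_div_cancel hp0.ne', ENNReal.rpow_one, mul_assoc]
      _ ≤ _ := by
          gcongr
          push_cast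
          rw [ENNReal.coe_toNNReal hC]
          exact le_self_add
  · intro x hx y hy hxy
    rw [hw, ← ENNReal.ofReal_mul (by positivity)]
    refine ENNReal.ofReal_le_ofReal (le_pow_mul_of_doubling hpos hmono hdbl m (hFpos x hx)
      (hFpos y hy) ?_)
    have h1 : Metric.infDist x F ≤ Metric.infDist y F + dist x y :=
      Metric.infDist_le_infDist_add_dist
    rw [dist_comm] at h1
    have h2 : 3 * J * Metric.infDist y Ωᶜ ≤ 3 * J * Metric.infDist y F :=
      mul_le_mul_of_nonneg_left (hδF y) (by linarith)
    have h3 := mul_le_mul_of_nonneg_right hm.le (hFpos y hy).le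
    linarith
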